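/- Let $d\ge 2$, $n=\lfloor d/2\rfloor$, let $\lambda_1,\dots,\lambda_d$ be real or complex numbers, not all zero, and put $p(x)=\sum_{i=1}^{d}\lambda_i x^i$. Consider the Liénard vector field $$X=x\,\partial_y-y\,\partial_x+p(x)\,y\,\partial_y ,$$ whose orbits in polar coordinates $x=r\cos\theta$, $y=r\sin\theta$ satisfy $$\frac{dr}{d\theta}=\frac{r\,p(r\cos\theta)\sin^2\theta}{1+\sin\theta\cos\theta\,p(r\cos\theta)} .$$ The complexified first return map of $X$ sends $r(0)\in\mathbb{C}$ to $r(2\pi)\in\mathbb{C}$, where $r:[0,2\pi]\to\mathbb{C}$ is a solution of this equation ($\theta$ real, denominator nonvanishing along the solution). A complex limit cycle of $X$ on a disc $D(0,R)\subset\mathbb{C}$ is a nonzero fixed point of this map in $D(0,R)$ that is isolated among its fixed points. There is a unique real number $\rho>0$ with $\sum_{i=1}^{d}\rho^i|\lambda_i|=1$. Let $$R'(\rho)=\frac{\rho\,c_{2n+1}^{\,n}}{\pi^2\,n\,2^{14n}},\qquad c_{2n+1}=\int_0^{2\pi}\cos^{2n}\theta\,\sin^2\theta\,d\theta .$$ Then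 the complexified first return map is well defined (single-valued) and holomorphic on the open disc $D(0,R'(\rho))$, and $X$ has fewer than $2n$ complex limit cycles on $D(0,R'(\rho))$. -/

import Mathlib

noncomputable section

namespace Lienard

/-- The polynomial `p(x) = λ₁ x + ⋯ + λ_d x^d` (no constant term, so that the linear part of the
vector field is a center). Only the values `lam 1, …, lam d` matter. -/
def damping (d : ℕ) (lam : ℕ → ℂ) : Polynomial ℂ :=
  ∑ i ∈ Finset.Icc 1 d, Polynomial.C (lam i) * Polynomial.X ^ i

/-- The (complexified) Liénard vector field `X = x ∂_y - y ∂_x + p(x) y ∂_y`. -/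
def field (p : Polynomial ℂ) (z : ℂ × ℂ) : ℂ × ℂ :=
  (-z.2, z.1 + p.eval z.1 * z.2)

/-- The radial speed `ṙ` of `X` at `(x, y) = (r cos θ, r sin θ)`, with `r` complex, `θ` real. -/
def radialSpeed (p : Polynomial ℂ) (r : ℂ) (θ : ℝ) : ℂ :=
  r * p.eval (r * (Real.cos θ : ℂ)) * (Real.sin θ : ℂ) ^ 2

/-- The angular speed `θ̇` of `X` at `(x, y) = (r cos θ, r sin θ)`, with `r` complex, `θ` real. -/
def angularSpeed (p : Polynomial ℂ) (r : ℂ) (θ : ℝ) : ℂ :=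
  1 + (Real.sin θ : ℂ) * (Real.cos θ : ℂ) * p.eval (r * (Real.cos θ : ℂ))

/-- `X = ṙ e_r + r θ̇ e_θ`, where `e_r = (cos θ, sin θ)` and `e_θ = (-sin θ, cos θ)`. -/
theorem field_polar (p : Polynomial ℂ) (r : ℂ) (θ : ℝ) :
    field p (r * (Real.cos θ : ℂ), r * (Real.sin θ : ℂ)) =
      radialSpeed p r θ • ((Real.cos θ : ℂ), (Real.sin θ : ℂ)) +
        (r * angularSpeed p r θ) • (-(Real.sin θ : ℂ), (Real.cos θ : ℂ)) := by
  have h : (Real.sin θ : ℂ) ^ 2 + (Real.cos θ : ℂ) ^ 2 = 1 := by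
    exact_mod_cast Real.sin_sq_add_cos_sq θ
  ext
  · simp only [field, radialSpeed, angularSpeed, Prod.smul_mk, Prod.mk_add_mk, smul_eq_mul]
    ring
  · simp only [field, radialSpeed, angularSpeed, Prod.smul_mk, Prod.mk_add_mk, smul_eq_mul]
    linear_combination
      (-(r * p.eval (r * (Real.cos θ : ℂ)) * (Real.sin θ : ℂ))) * h

/-- `r : [0, 2π] → ℂ` is a solution, over one full turn, of the orbit equation of `X` in polar
coordinates, `dr/dθ = r p(r cos θ) sin² θ / (1 + sin θ cos θ p(r cos θ))`; the denominator is
required not to vanish along the solution. -/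
structure IsTurn (p : Polynomial ℂ) (r : ℝ → ℂ) : Prop where
  regular : ∀ θ ∈ Set.Icc (0 : ℝ) (2 * Real.pi), angularSpeed p (r θ) θ ≠ 0
  orbit : ∀ θ ∈ Set.Icc (0 : ℝ) (2 * Real.pi),
    HasDerivWithinAt r (radialSpeed p (r θ) θ / angularSpeed p (r θ) θ)
      (Set.Icc (0 : ℝ) (2 * Real.pi)) θ

/-- The complexified first return map of `X` on the section `θ = 0`, as a relation: it sends `x`
to `y` if the orbit through `r = x` at `θ = 0` can be followed over one full turn and has `r = y`
at `θ = 2π`. -/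
def ReturnsTo (p : Polynomial ℂ) (x y : ℂ) : Prop :=
  ∃ r : ℝ → ℂ, IsTurn p r ∧ r 0 = x ∧ r (2 * Real.pi) = y

/-- A complex limit cycle: a nonzero fixed point of the complexified first return map which is
isolated among the fixed points. -/
def IsComplexLimitCycle (p : Polynomial ℂ) (x : ℂ) : Prop :=
  x ≠ 0 ∧ ReturnsTo p x x ∧ ∀ᶠ z in nhdsWithin x {x}ᶜ, ¬ ReturnsTo p z z

/-- The constant `c_{2n+1} = ∫_0^{2π} cos^{2n} θ sin² θ dθ`. -/
def wallisConst (n : ℕ) : ℝ :=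
  ∫ θ in (0 : ℝ)..(2 * Real.pi), Real.cos θ ^ (2 * n) * Real.sin θ ^ 2

/-- The radius `R'(ρ) = ρ c_{2n+1}^n / (π² n 2^{14 n})`. -/
def cycleRadius (n : ℕ) (ρ : ℝ) : ℝ :=
  ρ * wallisConst n ^ n / (Real.pi ^ 2 * n * 2 ^ (14 * n))

end Lienard

end

noncomputable section

namespace Lienard

open Set

/-! Substituting `x = ρ u` reduces everything to `∑ |λ_i| ≤ 1`. Orbits starting in the disc of
radius `1/32` then stay in the disc of radius `1/16` for a full turn, so the return map `P` is
defined there. The difference of two orbits solves a linear equation whose coefficient is a divided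
difference; this one device gives uniqueness, growth bounds and holomorphy.

If `p` is odd, the reflections `θ ↦ π - θ` and `θ ↦ 3π - θ` preserve the orbit equation and every
orbit closes up. For general `p`, compare the orbit from `x` with the orbit from `x` of the odd
part. Variation of constants yields `P(x) - x = ∑ λ_{2k} (c_{2k+1} x^{2k+1} + O(x^{2k+2}))`, with an
error proportional to each `|λ_{2k}|` separately (`norm_returnMap_sub_le`).

Hence `G = (P(x) - x)/x³` is close to an even polynomial of degree at most `2n - 2`. Let `m` be the
largest of its terms `|λ_{2k+2}| ε^{2k}` on `|x| = ε`. On a fixed circle `|x| = S`, `G` is at most a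
constant times `m (S/ε)^{2n-2}`, while `2n` zeros in `|x| < ε` gain a factor `(3ε/S)^{2n}`. The
surplus `(ε/S)²` makes `G` so small on `|x| = ε` that Cauchy's estimate forces `m = 0`
(`coeff_eq_zero_of_zeros`). So `2n` nonzero fixed points make `p` odd; then every point is fixed and
no fixed point is isolated. -/

/-! ### Linear equations, divided differences and uniqueness. -/

/-- Variation of constants: the derivative of `exp (-∫ A) * δ` is `exp (-∫ A) * B`. With `B = 0` it
replaces Grönwall's inequality by an exact formula. -/
theorem linear_ode_solution {a b : ℝ} (hab : a ≤ b) {A B δ : ℝ → ℂ} (hA : Continuous A)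
    (hB : Continuous B) (hc : ContinuousOn δ (Icc a b))
    (hδ : ∀ θ ∈ Ioo a b, HasDerivAt δ (A θ * δ θ + B θ) θ) :
    δ b = Complex.exp (∫ s in a..b, A s) *
      (δ a + ∫ s in a..b, Complex.exp (-∫ u in a..s, A u) * B s) := by
  have hI : ∀ θ, HasDerivAt (fun t => ∫ u in a..t, A u) (A θ) θ := fun θ =>
    intervalIntegral.integral_hasDerivAt_right (hA.intervalIntegrable _ _)
      hA.stronglyMeasurable.stronglyMeasurableAtFilter hA.continuousAt
  have hIc : Continuous (fun t => ∫ u in a..t, A u) :=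
    continuous_iff_continuousAt.2 fun θ => (hI θ).continuousAt
  have key : ∫ s in a..b, Complex.exp (-∫ u in a..s, A u) * B s =
      Complex.exp (-∫ u in a..b, A u) * δ b - Complex.exp (-∫ u in a..a, A u) * δ a := by
    refine intervalIntegral.integral_eq_sub_of_hasDerivAt_of_le hab
      (f := fun s => Complex.exp (-∫ u in a..s, A u) * δ s) ?_ ?_ ?_
    · exact (Complex.continuous_exp.comp hIc.neg).continuousOn.mul hc
    · intro θ hθ
      have := ((hI θ).neg.cexp).mul (hδ θ hθ)
      refine this.congr_deriv ?_
      simp only [Pi.neg_apply]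
      ring
    · exact ((Complex.continuous_exp.comp hIc.neg).mul hB).intervalIntegrable _ _
  rw [key, intervalIntegral.integral_same, neg_zero, Complex.exp_zero, one_mul,
    add_sub_cancel, ← mul_assoc, ← Complex.exp_add, add_neg_cancel, Complex.exp_zero, one_mul]

theorem eval_damping (d : ℕ) (lam : ℕ → ℂ) (u : ℂ) :
    (damping d lam).eval u = ∑ i ∈ Finset.Icc 1 d, lam i * u ^ i := by
  simp [damping, Polynomial.eval_finsetSum]

/-- The divided difference of the polynomial `damping d lam` at `u` and `v`. -/
def dampingSlope (d : ℕ) (lam : ℕ → ℂ) (u v : ℂ) : ℂ :=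
  ∑ i ∈ Finset.Icc 1 d, lam i * ∑ j ∈ Finset.range i, u ^ j * v ^ (i - 1 - j)

theorem dampingSlope_mul_sub (d : ℕ) (lam : ℕ → ℂ) (u v : ℂ) :
    dampingSlope d lam u v * (u - v) = (damping d lam).eval u - (damping d lam).eval v := by
  rw [eval_damping, eval_damping, dampingSlope, Finset.sum_mul, ← Finset.sum_sub_distrib]
  refine Finset.sum_congr rfl fun i _ => ?_
  rw [mul_assoc, Commute.geom_sum₂_mul (Commute.all u v), mul_sub]

/-- The divided difference in `r`, at `a` and `b`, of the right-hand side of the orbit equation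
in polar coordinates. -/
def orbitSlope (d : ℕ) (lam : ℕ → ℂ) (a b : ℂ) (θ : ℝ) : ℂ :=
  (Real.sin θ : ℂ) ^ 2 * ((damping d lam).eval (a * (Real.cos θ : ℂ)) +
      b * (Real.cos θ : ℂ) * dampingSlope d lam (a * (Real.cos θ : ℂ)) (b * (Real.cos θ : ℂ)) +
      (Real.sin θ : ℂ) * (Real.cos θ : ℂ) * (damping d lam).eval (a * (Real.cos θ : ℂ)) *
        (damping d lam).eval (b * (Real.cos θ : ℂ))) /
    (angularSpeed (damping d lam) a θ * angularSpeed (damping d lam) b θ)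

theorem orbitSlope_mul_sub {d : ℕ} {lam : ℕ → ℂ} {a b : ℂ} {θ : ℝ}
    (ha : angularSpeed (damping d lam) a θ ≠ 0) (hb : angularSpeed (damping d lam) b θ ≠ 0) :
    orbitSlope d lam a b θ * (a - b) =
      radialSpeed (damping d lam) a θ / angularSpeed (damping d lam) a θ -
        radialSpeed (damping d lam) b θ / angularSpeed (damping d lam) b θ := by
  have h := dampingSlope_mul_sub d lam (a * (Real.cos θ : ℂ)) (b * (Real.cos θ : ℂ))
  rw [orbitSlope, div_sub_div _ _ ha hb, div_mul_eq_mul_div]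
  congr 1
  simp only [radialSpeed, angularSpeed]
  linear_combination ((Real.sin θ : ℂ) ^ 2 * b) * h

theorem continuous_angularSpeed (p : Polynomial ℂ) :
    Continuous fun z : ℂ × ℝ => angularSpeed p z.1 z.2 := by
  have := p.continuous
  unfold angularSpeed
  fun_prop

theorem continuous_radialSpeed (p : Polynomial ℂ) :
    Continuous fun z : ℂ × ℝ => radialSpeed p z.1 z.2 := by
  have := p.continuous
  unfold radialSpeed
  fun_prop

theorem continuousOn_orbitSlope (d : ℕ) (lam : ℕ → ℂ) :
    ContinuousOn (fun z : ℂ × ℂ × ℝ => orbitSlope d lam z.1 z.2.1 z.2.2)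
      {z | angularSpeed (damping d lam) z.1 z.2.2 ≠ 0 ∧
        angularSpeed (damping d lam) z.2.1 z.2.2 ≠ 0} := by
  have h1 := (damping d lam).continuous
  have h2 := continuous_angularSpeed (damping d lam)
  refine ContinuousOn.div (Continuous.continuousOn ?_) (Continuous.continuousOn ?_)
    fun z hz => mul_ne_zero hz.1 hz.2
  · unfold dampingSlope
    fun_prop
  · exact (h2.comp (by fun_prop : Continuous fun z : ℂ × ℂ × ℝ => (z.1, z.2.2))).mul
      (h2.comp (by fun_prop : Continuous fun z : ℂ × ℂ × ℝ => (z.2.1, z.2.2)))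

/-- The orbit equation in polar coordinates has at most one solution through a given point. -/
theorem IsTurn.eq_of_eq_zero {d : ℕ} {lam : ℕ → ℂ} {r r' : ℝ → ℂ}
    (h : IsTurn (damping d lam) r) (h' : IsTurn (damping d lam) r') (h0 : r 0 = r' 0) :
    r (2 * Real.pi) = r' (2 * Real.pi) := by
  have hpi : (0 : ℝ) ≤ 2 * Real.pi := by positivity
  have hr : ContinuousOn r (Icc 0 (2 * Real.pi)) := fun θ hθ => (h.orbit θ hθ).continuousWithinAt
  have hr' : ContinuousOn r' (Icc 0 (2 * Real.pi)) :=
    fun θ hθ => (h'.orbit θ hθ).continuousWithinAt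
  have hA : ContinuousOn (fun θ => orbitSlope d lam (r θ) (r' θ) θ) (Icc 0 (2 * Real.pi)) :=
    ContinuousOn.comp (f := fun θ => (r θ, r' θ, θ)) (continuousOn_orbitSlope d lam)
      (hr.prodMk (hr'.prodMk continuousOn_id)) fun θ hθ => ⟨h.regular θ hθ, h'.regular θ hθ⟩
  -- Turns are controlled only on `[0, 2π]`, and need not be small; the coefficient is extended by
  -- constants to be continuous on the whole line.
  obtain ⟨A, hAc, hAr⟩ : ∃ A : ℝ → ℂ, Continuous A ∧
      ∀ θ ∈ Icc 0 (2 * Real.pi), A θ = orbitSlope d lam (r θ) (r' θ) θ := by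
    refine ⟨IccExtend hpi (domRestrict _ fun θ => orbitSlope d lam (r θ) (r' θ) θ),
      (continuousOn_iff_continuous_domRestrict.1 hA).Icc_extend', fun θ hθ => ?_⟩
    rw [IccExtend_of_mem _ _ hθ, domRestrict_apply]
  have hδ : ∀ θ ∈ Ioo 0 (2 * Real.pi),
      HasDerivAt (fun θ => r θ - r' θ) (A θ * (r θ - r' θ) + 0) θ := by
    intro θ hθ
    have hθ' := Ioo_subset_Icc_self hθ
    have hn := Icc_mem_nhds hθ.1 hθ.2
    refine (((h.orbit θ hθ').hasDerivAt hn).fun_sub ((h'.orbit θ hθ').hasDerivAt hn)).congr_deriv ?_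
    rw [hAr θ hθ', ← orbitSlope_mul_sub (h.regular θ hθ') (h'.regular θ hθ'), add_zero]
  have := linear_ode_solution hpi hAc (B := fun _ => 0) continuous_const (hr.fun_sub hr') hδ
  simp only [h0, sub_self, mul_zero, intervalIntegral.integral_zero, add_zero] at this
  exact sub_eq_zero.1 this

/-! ### Estimates for the normalized equation near the origin. -/

section Bounds

variable {d : ℕ} {lam : ℕ → ℂ} {σ : ℝ} {u v a b : ℂ}

/-- The bound is linear in `σ` because `p` has no constant term. -/
theorem norm_eval_damping_le (hlam : ∑ i ∈ Finset.Icc 1 d, ‖lam i‖ ≤ 1) (hσ : σ ≤ 1)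
    (hu : ‖u‖ ≤ σ) : ‖(damping d lam).eval u‖ ≤ σ := by
  have h0 : 0 ≤ σ := (norm_nonneg u).trans hu
  rw [eval_damping]
  calc ‖∑ i ∈ Finset.Icc 1 d, lam i * u ^ i‖ ≤ ∑ i ∈ Finset.Icc 1 d, ‖lam i‖ * σ := by
        refine norm_sum_le_of_le _ fun i hi => ?_
        rw [norm_mul, norm_pow]
        gcongr
        calc ‖u‖ ^ i ≤ σ ^ i := by gcongr
          _ ≤ σ ^ 1 := pow_le_pow_of_le_one h0 hσ (Finset.mem_Icc.1 hi).1
          _ = σ := pow_one σ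
    _ ≤ σ := by
        rw [← Finset.sum_mul]
        exact mul_le_of_le_one_left h0 hlam

theorem norm_dampingSlope_le (hlam : ∑ i ∈ Finset.Icc 1 d, ‖lam i‖ ≤ 1) (hu : ‖u‖ ≤ 1 / 2)
    (hv : ‖v‖ ≤ 1 / 2) : ‖dampingSlope d lam u v‖ ≤ 1 := by
  refine (norm_sum_le_of_le _ fun i hi => ?_).trans hlam
  rw [norm_mul]
  refine mul_le_of_le_one_right (norm_nonneg _) ?_
  have h1 : ‖∑ j ∈ Finset.range i, u ^ j * v ^ (i - 1 - j)‖ ≤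
      ∑ j ∈ Finset.range i, (1 / 2 : ℝ) ^ (i - 1) := by
    refine norm_sum_le_of_le _ fun j hj => ?_
    have hj' := Finset.mem_range.1 hj
    rw [norm_mul, norm_pow, norm_pow]
    calc ‖u‖ ^ j * ‖v‖ ^ (i - 1 - j) ≤ (1 / 2) ^ j * (1 / 2) ^ (i - 1 - j) := by gcongr
      _ = (1 / 2) ^ (i - 1) := by rw [← pow_add]; congr 1; omega
  -- It remains to see `i (1/2)^(i-1) ≤ 1`, that is `i ≤ 2^(i-1)`; the radius `1/2` is chosen for
  -- this.
  refine h1.trans ?_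
  rw [Finset.sum_const, Finset.card_range, nsmul_eq_mul, div_pow, one_pow, mul_one_div,
    div_le_one (by positivity)]
  have : i ≤ 2 ^ (i - 1) := by
    have := Nat.lt_two_pow_self (n := i - 1)
    omega
  exact_mod_cast this

theorem norm_cos_le_one (θ : ℝ) : ‖(Real.cos θ : ℂ)‖ ≤ 1 := by
  rw [Complex.norm_real]; exact Real.abs_cos_le_one θ

theorem norm_sin_le_one (θ : ℝ) : ‖(Real.sin θ : ℂ)‖ ≤ 1 := by
  rw [Complex.norm_real]; exact Real.abs_sin_le_one θ

theorem norm_mul_cos_le (ha : ‖a‖ ≤ σ) (θ : ℝ) : ‖a * (Real.cos θ : ℂ)‖ ≤ σ := by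
  rw [norm_mul]
  exact (mul_le_of_le_one_right (norm_nonneg _) (norm_cos_le_one θ)).trans ha

theorem norm_sin_mul_cos_le_one (θ : ℝ) : ‖(Real.sin θ : ℂ) * (Real.cos θ : ℂ)‖ ≤ 1 := by
  rw [norm_mul]
  exact mul_le_one₀ (norm_sin_le_one θ) (norm_nonneg _) (norm_cos_le_one θ)

theorem norm_angularSpeed_sub_one_le (hlam : ∑ i ∈ Finset.Icc 1 d, ‖lam i‖ ≤ 1) (hσ : σ ≤ 1)
    (ha : ‖a‖ ≤ σ) (θ : ℝ) : ‖angularSpeed (damping d lam) a θ - 1‖ ≤ σ := by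
  rw [angularSpeed, add_sub_cancel_left, norm_mul]
  exact (mul_le_of_le_one_left (norm_nonneg _) (norm_sin_mul_cos_le_one θ)).trans
    (norm_eval_damping_le hlam hσ (norm_mul_cos_le ha θ))

theorem one_sub_le_norm_angularSpeed (hlam : ∑ i ∈ Finset.Icc 1 d, ‖lam i‖ ≤ 1) (hσ : σ ≤ 1)
    (ha : ‖a‖ ≤ σ) (θ : ℝ) : 1 - σ ≤ ‖angularSpeed (damping d lam) a θ‖ := by
  have h1 := norm_angularSpeed_sub_one_le hlam hσ ha θ
  have h2 := norm_sub_norm_le (1 : ℂ) (1 - angularSpeed (damping d lam) a θ)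
  rw [sub_sub_cancel, norm_one, norm_sub_rev] at h2
  linarith

theorem angularSpeed_ne_zero (hlam : ∑ i ∈ Finset.Icc 1 d, ‖lam i‖ ≤ 1) (ha : ‖a‖ ≤ 1 / 16)
    (θ : ℝ) : angularSpeed (damping d lam) a θ ≠ 0 := by
  have := one_sub_le_norm_angularSpeed hlam (by norm_num) ha θ
  rw [← norm_pos_iff]
  linarith

theorem norm_orbit_speed_le (hlam : ∑ i ∈ Finset.Icc 1 d, ‖lam i‖ ≤ 1) (ha : ‖a‖ ≤ 1 / 16)
    (θ : ℝ) : ‖radialSpeed (damping d lam) a θ / angularSpeed (damping d lam) a θ‖ ≤ 1 / 240 := by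
  have h1 := one_sub_le_norm_angularSpeed hlam (by norm_num) ha θ
  have h2 := norm_eval_damping_le hlam (by norm_num) (norm_mul_cos_le ha θ)
  have h3 : ‖radialSpeed (damping d lam) a θ‖ ≤ 1 / 16 * (1 / 16) * 1 ^ 2 := by
    rw [radialSpeed, norm_mul, norm_mul, norm_pow]
    gcongr
    exact norm_sin_le_one θ
  rw [norm_div, div_le_iff₀ (by linarith)]
  linarith

/-- The numerator is at most `2σ + σ²` and the denominator at least `(15/16)²`. -/
theorem norm_orbitSlope_le (hlam : ∑ i ∈ Finset.Icc 1 d, ‖lam i‖ ≤ 1) (hσ : σ ≤ 1 / 16)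
    (ha : ‖a‖ ≤ σ) (hb : ‖b‖ ≤ σ) (θ : ℝ) : ‖orbitSlope d lam a b θ‖ ≤ 3 * σ := by
  have h0 : 0 ≤ σ := (norm_nonneg a).trans ha
  have hσ1 : σ ≤ 1 := by linarith
  have ha' := norm_mul_cos_le ha θ
  have hb' := norm_mul_cos_le hb θ
  have h1 := one_sub_le_norm_angularSpeed hlam hσ1 ha θ
  have h2 := one_sub_le_norm_angularSpeed hlam hσ1 hb θ
  have h3 : (15 / 16 : ℝ) * (15 / 16) ≤ ‖angularSpeed (damping d lam) a θ‖ *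
      ‖angularSpeed (damping d lam) b θ‖ :=
    mul_le_mul (by linarith) (by linarith) (by norm_num) (norm_nonneg _)
  have hpa := norm_eval_damping_le hlam hσ1 ha'
  have hpb := norm_eval_damping_le hlam hσ1 hb'
  have hq := norm_dampingSlope_le hlam (ha'.trans (by linarith)) (hb'.trans (by linarith))
  rw [orbitSlope, norm_div, norm_mul, norm_mul, div_le_iff₀ (by linarith)]
  have hN : ‖(damping d lam).eval (a * (Real.cos θ : ℂ)) +
      b * (Real.cos θ : ℂ) * dampingSlope d lam (a * (Real.cos θ : ℂ)) (b * (Real.cos θ : ℂ)) +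
      (Real.sin θ : ℂ) * (Real.cos θ : ℂ) * (damping d lam).eval (a * (Real.cos θ : ℂ)) *
        (damping d lam).eval (b * (Real.cos θ : ℂ))‖ ≤ σ + σ * 1 + 1 * σ * σ := by
    refine (norm_add₃_le).trans ?_
    gcongr
    · rw [norm_mul]; gcongr
    · rw [norm_mul, norm_mul]
      gcongr
      exact norm_sin_mul_cos_le_one θ
  have hs : ‖(Real.sin θ : ℂ) ^ 2‖ ≤ 1 := by
    rw [norm_pow]; exact pow_le_one₀ (norm_nonneg _) (norm_sin_le_one θ)
  calc _ ≤ 1 * (σ + σ * 1 + 1 * σ * σ) := by gcongr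
    _ ≤ 3 * σ * (15 / 16 * (15 / 16)) := by nlinarith
    _ ≤ _ := by gcongr

end Bounds

/-! ### Existence of small orbits and dependence on the starting point. -/

/-- `r` is a continuous curve that stays in the disc of radius `1 / 16`, starts at `x`, and solves
on `[0, 2π]` the orbit equation in polar coordinates. -/
structure IsSmallOrbit (d : ℕ) (lam : ℕ → ℂ) (x : ℂ) (r : ℝ → ℂ) : Prop where
  continuous : Continuous r
  norm_le : ∀ θ, ‖r θ‖ ≤ 1 / 16
  start : r 0 = x
  orbit : ∀ θ ∈ Icc (0 : ℝ) (2 * Real.pi), HasDerivWithinAt r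
    (radialSpeed (damping d lam) (r θ) θ / angularSpeed (damping d lam) (r θ) θ)
    (Icc (0 : ℝ) (2 * Real.pi)) θ

theorem continuous_orbitSlope_comp {d : ℕ} {lam : ℕ → ℂ}
    (hlam : ∑ i ∈ Finset.Icc 1 d, ‖lam i‖ ≤ 1) {r r' : ℝ → ℂ} (hr : Continuous r)
    (hr' : Continuous r') (hb : ∀ θ, ‖r θ‖ ≤ 1 / 16) (hb' : ∀ θ, ‖r' θ‖ ≤ 1 / 16) :
    Continuous fun θ => orbitSlope d lam (r θ) (r' θ) θ :=
  ContinuousOn.comp_continuous (f := fun θ => (r θ, r' θ, θ)) (continuousOn_orbitSlope d lam)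
    (hr.prodMk (hr'.prodMk continuous_id)) fun θ =>
    ⟨angularSpeed_ne_zero hlam (hb θ) θ, angularSpeed_ne_zero hlam (hb' θ) θ⟩

theorem exists_isSmallOrbit {d : ℕ} {lam : ℕ → ℂ} (hlam : ∑ i ∈ Finset.Icc 1 d, ‖lam i‖ ≤ 1)
    {x : ℂ} (hx : ‖x‖ ≤ 1 / 32) : ∃ r, IsSmallOrbit d lam x r := by
  have hpi := Real.pi_lt_d2
  have hpi0 : (0 : ℝ) ≤ 2 * Real.pi := by positivity
  set F : ℝ → ℂ → ℂ := fun θ a =>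
    radialSpeed (damping d lam) a θ / angularSpeed (damping d lam) a θ with hF
  have hb {a : ℂ} (ha : a ∈ Metric.closedBall (0 : ℂ) ((1 / 16 : NNReal) : ℝ)) :
      ‖a‖ ≤ 1 / 16 := by simpa using ha
  -- At speed at most `1/240` for time `2π`, an orbit moves by less than `1/32 = 1/16 - 1/32`.
  have hPL : IsPicardLindelof F (tmin := 0) (tmax := 2 * Real.pi) ⟨0, le_rfl, hpi0⟩ (0 : ℂ)
      (1 / 16) (1 / 32) (1 / 240) 1 := by
    refine ⟨fun θ _ => ?_, fun a ha => ?_, fun θ _ a ha => ?_, ?_⟩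
    · refine LipschitzOnWith.of_dist_le_mul fun a ha b hb' => ?_
      rw [dist_eq_norm, dist_eq_norm, hF, ← orbitSlope_mul_sub
        (angularSpeed_ne_zero hlam (hb ha) θ) (angularSpeed_ne_zero hlam (hb hb') θ), norm_mul]
      refine mul_le_mul_of_nonneg_right ?_ (norm_nonneg _)
      refine (norm_orbitSlope_le hlam le_rfl (hb ha) (hb hb') θ).trans ?_
      norm_num
    · have hc : Continuous fun θ : ℝ => (a, θ) := by fun_prop
      exact (((continuous_radialSpeed _).comp hc).div₀ ((continuous_angularSpeed _).comp hc)
        fun θ => angularSpeed_ne_zero hlam (hb ha) θ).continuousOn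
    · exact (norm_orbit_speed_le hlam (hb ha) θ).trans (by simp)
    · have : max (2 * Real.pi - 0) ((0 : ℝ) - 0) = 2 * Real.pi := by
        rw [sub_zero, sub_zero, max_eq_left hpi0]
      simp only [this]
      push_cast
      linarith
  have hx' : x ∈ Metric.closedBall (0 : ℂ) ((1 / 32 : NNReal) : ℝ) := by simpa using hx
  -- The fixed point of the Picard operator is used directly: its extension `compProj` is continuous
  -- and confined to the disc for all real `θ`.
  obtain ⟨α, hα⟩ := ODE.FunSpace.exists_isFixedPt_next hPL hx'
  have hmem : ∀ θ, α.compProj θ ∈ Metric.closedBall (0 : ℂ) ((1 / 16 : NNReal) : ℝ) :=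
    fun θ => α.compProj_mem_closedBall hPL.mul_max_le
  have h0 : (0 : ℝ) ∈ Icc 0 (2 * Real.pi) := ⟨le_rfl, hpi0⟩
  refine ⟨α.compProj, α.continuous_compProj, fun θ => hb (hmem θ), ?_, fun θ hθ => ?_⟩
  · rw [ODE.FunSpace.compProj_of_mem h0, ← hα, ODE.FunSpace.next_apply₀]
  · refine HasDerivWithinAt.congr_of_mem (ODE.hasDerivWithinAt_picard_Icc h0 hPL.continuousOn_uncurry
      α.continuous_compProj.continuousOn (fun θ _ => hmem θ) x hθ) (fun θ' hθ' => ?_) hθ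
    nth_rewrite 1 [← hα]
    rw [ODE.FunSpace.compProj_of_mem hθ', ODE.FunSpace.next_apply]

theorem isSmallOrbit_zero (d : ℕ) (lam : ℕ → ℂ) : IsSmallOrbit d lam 0 fun _ => 0 where
  continuous := continuous_const
  norm_le _ := by simp
  start := rfl
  orbit θ _ := by simpa [radialSpeed] using hasDerivWithinAt_const θ _ (0 : ℂ)

namespace IsSmallOrbit

variable {d : ℕ} {lam : ℕ → ℂ} {x y : ℂ} {r r' : ℝ → ℂ} {θ : ℝ}

theorem isTurn (h : IsSmallOrbit d lam x r) (hlam : ∑ i ∈ Finset.Icc 1 d, ‖lam i‖ ≤ 1) :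
    IsTurn (damping d lam) r :=
  ⟨fun θ _ => angularSpeed_ne_zero hlam (h.norm_le θ) θ, h.orbit⟩

/-- The difference of two orbits solves the homogeneous linear equation with coefficient
`orbitSlope`. All dependence on the initial value is read off from this formula. -/
theorem sub_eq (h : IsSmallOrbit d lam x r) (h' : IsSmallOrbit d lam y r')
    (hlam : ∑ i ∈ Finset.Icc 1 d, ‖lam i‖ ≤ 1) (hθ : θ ∈ Icc 0 (2 * Real.pi)) :
    r θ - r' θ = Complex.exp (∫ s in (0 : ℝ)..θ, orbitSlope d lam (r s) (r' s) s) * (x - y) := by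
  have := linear_ode_solution hθ.1
    (continuous_orbitSlope_comp hlam h.continuous h'.continuous h.norm_le h'.norm_le)
    (B := fun _ => 0) continuous_const (h.continuous.sub h'.continuous).continuousOn
    fun t ht => ?_
  · simpa [h.start, h'.start] using this
  · have hn : Icc 0 (2 * Real.pi) ∈ nhds t := Icc_mem_nhds ht.1 (ht.2.trans_le hθ.2)
    have ht' := mem_of_mem_nhds hn
    refine (((h.orbit t ht').hasDerivAt hn).sub ((h'.orbit t ht').hasDerivAt hn)).congr_deriv ?_
    rw [← orbitSlope_mul_sub (angularSpeed_ne_zero hlam (h.norm_le t) t)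
      (angularSpeed_ne_zero hlam (h'.norm_le t) t), add_zero]
    rfl

/-- The constant comes from `3 · (1/16) · 2π < 6/5`. -/
theorem norm_integral_orbitSlope_le (h : IsSmallOrbit d lam x r) (h' : IsSmallOrbit d lam y r')
    (hlam : ∑ i ∈ Finset.Icc 1 d, ‖lam i‖ ≤ 1) (hθ : θ ∈ Icc 0 (2 * Real.pi)) :
    ‖∫ s in (0 : ℝ)..θ, orbitSlope d lam (r s) (r' s) s‖ ≤ 6 / 5 := by
  have hpi := Real.pi_lt_d2
  refine (intervalIntegral.norm_integral_le_of_norm_le_const fun s _ =>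
    norm_orbitSlope_le hlam le_rfl (h.norm_le s) (h'.norm_le s) s).trans ?_
  rw [sub_zero, abs_of_nonneg hθ.1]
  linarith [hθ.2]

theorem norm_sub_le (h : IsSmallOrbit d lam x r) (h' : IsSmallOrbit d lam y r')
    (hlam : ∑ i ∈ Finset.Icc 1 d, ‖lam i‖ ≤ 1) (hθ : θ ∈ Icc 0 (2 * Real.pi)) :
    ‖r θ - r' θ‖ ≤ 4 * ‖x - y‖ := by
  have he : Real.exp (6 / 5) ≤ 4 := by
    have h1 := Real.exp_one_lt_d9
    have h2 := Real.one_sub_le_exp_neg (1 / 5)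
    have h3 : Real.exp (6 / 5) * Real.exp (-(1 / 5)) = Real.exp 1 := by
      rw [← Real.exp_add]; norm_num
    nlinarith [Real.exp_pos (6 / 5)]
  rw [h.sub_eq h' hlam hθ, norm_mul]
  gcongr
  calc _ ≤ Real.exp ‖∫ s in (0 : ℝ)..θ, orbitSlope d lam (r s) (r' s) s‖ :=
        Complex.norm_exp_le_exp_norm _
    _ ≤ Real.exp (6 / 5) := by gcongr; exact h.norm_integral_orbitSlope_le h' hlam hθ
    _ ≤ 4 := he

theorem norm_le_mul (h : IsSmallOrbit d lam x r) (hlam : ∑ i ∈ Finset.Icc 1 d, ‖lam i‖ ≤ 1)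
    (hθ : θ ∈ Icc 0 (2 * Real.pi)) : ‖r θ‖ ≤ 4 * ‖x‖ := by
  simpa using h.norm_sub_le (isSmallOrbit_zero d lam) hlam hθ

/-- Both orbits have size at most `4‖x‖`, and `3 · 4 · 2π < 76`. Two coefficient families are
allowed so that an orbit of `p` can be paired with one of its odd part. -/
theorem norm_integral_orbitSlope_le_mul {lam' : ℕ → ℂ} (h : IsSmallOrbit d lam x r)
    (h' : IsSmallOrbit d lam' x r') (hlam : ∑ i ∈ Finset.Icc 1 d, ‖lam i‖ ≤ 1)
    (hlam' : ∑ i ∈ Finset.Icc 1 d, ‖lam' i‖ ≤ 1) (hx : ‖x‖ ≤ 1 / 64) {s t : ℝ}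
    (hs : s ∈ Icc 0 (2 * Real.pi)) (ht : t ∈ Icc 0 (2 * Real.pi)) :
    ‖∫ u in s..t, orbitSlope d lam' (r u) (r' u) u‖ ≤ 76 * ‖x‖ := by
  have hpi := Real.pi_lt_d2
  have hI : uIoc s t ⊆ Icc 0 (2 * Real.pi) := uIoc_subset_uIcc.trans (uIcc_subset_Icc hs ht)
  refine (intervalIntegral.norm_integral_le_of_norm_le_const fun u hu =>
    norm_orbitSlope_le hlam' (by linarith : 4 * ‖x‖ ≤ 1 / 16) (h.norm_le_mul hlam (hI hu))
      (h'.norm_le_mul hlam' (hI hu)) u).trans ?_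
  have : |t - s| ≤ 2 * Real.pi := by
    rw [abs_le]; constructor <;> linarith [hs.1, hs.2, ht.1, ht.2]
  calc _ ≤ 3 * (4 * ‖x‖) * (2 * Real.pi) := by gcongr
    _ ≤ 76 * ‖x‖ := by nlinarith [norm_nonneg x]

end IsSmallOrbit

/-! ### The first return map and its holomorphy. -/

/-- The complexified first return map on the disc of radius `1 / 32`. -/
def returnMap (d : ℕ) (lam : ℕ → ℂ) (x : ℂ) : ℂ :=
  open Classical in
  if h : ∃ r, IsSmallOrbit d lam x r then h.choose (2 * Real.pi) else 0

theorem IsSmallOrbit.returnMap_eq {d : ℕ} {lam : ℕ → ℂ} {x : ℂ} {r : ℝ → ℂ}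
    (h : IsSmallOrbit d lam x r) (hlam : ∑ i ∈ Finset.Icc 1 d, ‖lam i‖ ≤ 1) :
    returnMap d lam x = r (2 * Real.pi) := by
  have hex : ∃ r, IsSmallOrbit d lam x r := ⟨r, h⟩
  rw [returnMap, dif_pos hex]
  exact (hex.choose_spec.isTurn hlam).eq_of_eq_zero (h.isTurn hlam)
    (hex.choose_spec.start.trans h.start.symm)

theorem returnsTo_iff {d : ℕ} {lam : ℕ → ℂ} (hlam : ∑ i ∈ Finset.Icc 1 d, ‖lam i‖ ≤ 1)
    {x : ℂ} (hx : ‖x‖ ≤ 1 / 32) (y : ℂ) :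
    ReturnsTo (damping d lam) x y ↔ y = returnMap d lam x := by
  obtain ⟨r, hr⟩ := exists_isSmallOrbit hlam hx
  rw [hr.returnMap_eq hlam]
  constructor
  · rintro ⟨r', hr', h0, rfl⟩
    exact hr'.eq_of_eq_zero (hr.isTurn hlam) (h0.trans hr.start.symm)
  · rintro rfl
    exact ⟨r, hr.isTurn hlam, hr.start, rfl⟩

/-- By `IsSmallOrbit.sub_eq` the difference quotient at `x₀` is exactly `exp (I x)`, so continuity
of `I` at `x₀` already gives a complex derivative. -/
theorem differentiableOn_returnMap {d : ℕ} {lam : ℕ → ℂ}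
    (hlam : ∑ i ∈ Finset.Icc 1 d, ‖lam i‖ ≤ 1) :
    DifferentiableOn ℂ (returnMap d lam) (Metric.ball 0 (1 / 32)) := by
  have hpi : (0 : ℝ) ≤ 2 * Real.pi := by positivity
  have hball {x : ℂ} (hx : x ∈ Metric.ball (0 : ℂ) (1 / 32)) : ∃ r, IsSmallOrbit d lam x r :=
    exists_isSmallOrbit hlam (mem_ball_zero_iff.1 hx).le
  choose! r hr using fun x hx => @hball x hx
  intro x₀ hx₀
  have hn : Metric.ball (0 : ℂ) (1 / 32) ∈ nhds x₀ := Metric.isOpen_ball.mem_nhds hx₀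
  set I : ℂ → ℂ := fun x => ∫ s in (0 : ℝ)..2 * Real.pi, orbitSlope d lam (r x s) (r x₀ s) s
  have hI : ContinuousAt I x₀ := by
    refine intervalIntegral.continuousAt_of_dominated_interval (bound := fun _ => 1) ?_ ?_
      (by simp) (Filter.Eventually.of_forall fun s hs => ?_)
    · filter_upwards [hn] with x hx
      exact (continuous_orbitSlope_comp hlam (hr x hx).continuous (hr x₀ hx₀).continuous
        (hr x hx).norm_le (hr x₀ hx₀).norm_le).aestronglyMeasurable
    · filter_upwards [hn] with x hx
      refine Filter.Eventually.of_forall fun s _ => ?_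
      refine (norm_orbitSlope_le hlam le_rfl ((hr x hx).norm_le s)
        ((hr x₀ hx₀).norm_le s) s).trans (by norm_num)
    · have hs' : s ∈ Icc 0 (2 * Real.pi) := Ioc_subset_Icc_self (by rwa [uIoc_of_le hpi] at hs)
      have hrc : ContinuousAt (fun x => r x s) x₀ := by
        refine continuousAt_of_locally_lipschitz (r := 1 / 32 - ‖x₀‖) ?_ 4 fun x hx => ?_
        · have := mem_ball_zero_iff.1 hx₀
          linarith
        · have hx' : x ∈ Metric.ball (0 : ℂ) (1 / 32) := by
            rw [mem_ball_zero_iff]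
            rw [dist_eq_norm] at hx
            have := norm_le_norm_sub_add x x₀
            linarith
          rw [dist_eq_norm, dist_eq_norm]
          exact (hr x hx').norm_sub_le (hr x₀ hx₀) hlam hs'
      have hreg := angularSpeed_ne_zero hlam ((hr x₀ hx₀).norm_le s) s
      have hA : ContinuousAt (fun a => orbitSlope d lam a (r x₀ s) s) (r x₀ s) := by
        have hps := continuous_angularSpeed (damping d lam)
        have hO : IsOpen {z : ℂ × ℂ × ℝ | angularSpeed (damping d lam) z.1 z.2.2 ≠ 0 ∧
            angularSpeed (damping d lam) z.2.1 z.2.2 ≠ 0} :=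
          ((hps.comp (by fun_prop : Continuous fun z : ℂ × ℂ × ℝ => (z.1, z.2.2))).isOpen_preimage
              _ isOpen_compl_singleton).inter
            ((hps.comp (by fun_prop : Continuous fun z : ℂ × ℂ × ℝ => (z.2.1, z.2.2))
              ).isOpen_preimage _ isOpen_compl_singleton)
        exact ContinuousAt.comp (f := fun a => (a, r x₀ s, s))
          ((continuousOn_orbitSlope d lam).continuousAt (hO.mem_nhds ⟨hreg, hreg⟩))
          (by fun_prop)
      exact ContinuousAt.comp (g := fun a => orbitSlope d lam a (r x₀ s) s) hA hrc
  have hd : HasDerivAt (returnMap d lam) (Complex.exp (I x₀)) x₀ := by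
    rw [hasDerivAt_iff_tendsto_slope]
    refine ((hI.cexp.tendsto).mono_left nhdsWithin_le_nhds).congr' ?_
    filter_upwards [mem_nhdsWithin_of_mem_nhds hn, self_mem_nhdsWithin] with x hx hne
    rw [slope_def_field, (hr x hx).returnMap_eq hlam, (hr x₀ hx₀).returnMap_eq hlam,
      (hr x hx).sub_eq (hr x₀ hx₀) hlam ⟨hpi, le_rfl⟩,
      mul_div_cancel_right₀ _ (sub_ne_zero.2 hne)]
  exact hd.differentiableAt.differentiableWithinAt

/-! ### Odd damping: the center case. -/

/-- For odd `p` the reflection `θ ↦ 2m - θ` sends solutions to solutions. The orbit and its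
reflection agree at `θ = m`, hence on the whole half turn around `m`. -/
theorem IsSmallOrbit.eq_of_reflection {d : ℕ} {lam : ℕ → ℂ} {x : ℂ} {r : ℝ → ℂ}
    (h : IsSmallOrbit d lam x r) (hlam : ∑ i ∈ Finset.Icc 1 d, ‖lam i‖ ≤ 1)
    (hodd : ∀ u, (damping d lam).eval (-u) = -(damping d lam).eval u) {m : ℝ}
    (hcos : ∀ θ, Real.cos (2 * m - θ) = -Real.cos θ)
    (hsin : ∀ θ, Real.sin (2 * m - θ) = Real.sin θ)
    (hm : 0 ≤ m - Real.pi / 2) (hm' : m + Real.pi / 2 ≤ 2 * Real.pi) :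
    r (m - Real.pi / 2) = r (m + Real.pi / 2) := by
  have hpi := Real.pi_pos
  have hrefl : Continuous fun θ => r (2 * m - θ) := h.continuous.comp (by fun_prop)
  have hδ : ∀ θ ∈ Ioo (m - Real.pi / 2) m, HasDerivAt (fun θ => r θ - r (2 * m - θ))
      (orbitSlope d lam (r θ) (r (2 * m - θ)) θ * (r θ - r (2 * m - θ)) + 0) θ := by
    intro θ hθ
    have hn : Icc 0 (2 * Real.pi) ∈ nhds θ :=
      Icc_mem_nhds (by linarith [hθ.1]) (by linarith [hθ.2])
    have hn' : Icc 0 (2 * Real.pi) ∈ nhds (2 * m - θ) :=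
      Icc_mem_nhds (by linarith [hθ.2]) (by linarith [hθ.1])
    have h1 := (h.orbit θ (mem_of_mem_nhds hn)).hasDerivAt hn
    have h2 := ((h.orbit _ (mem_of_mem_nhds hn')).hasDerivAt hn').comp_const_sub (2 * m) θ
    refine (h1.fun_sub h2).congr_deriv ?_
    have hr : radialSpeed (damping d lam) (r (2 * m - θ)) (2 * m - θ) =
        -radialSpeed (damping d lam) (r (2 * m - θ)) θ := by
      simp only [radialSpeed, hcos, hsin, Complex.ofReal_neg, mul_neg, hodd, neg_mul]
    have ha : angularSpeed (damping d lam) (r (2 * m - θ)) (2 * m - θ) =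
        angularSpeed (damping d lam) (r (2 * m - θ)) θ := by
      simp only [angularSpeed, hcos, hsin, Complex.ofReal_neg, mul_neg, hodd, neg_mul, neg_neg]
    rw [orbitSlope_mul_sub (angularSpeed_ne_zero hlam (h.norm_le _) θ)
      (angularSpeed_ne_zero hlam (h.norm_le _) θ), hr, ha, add_zero, neg_div, neg_neg]
  have := linear_ode_solution (by linarith)
    (continuous_orbitSlope_comp hlam h.continuous hrefl h.norm_le fun θ => h.norm_le _)
    (B := fun _ => 0) continuous_const (h.continuous.sub hrefl).continuousOn hδ
  have hm2 : 2 * m - m = m := by ring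
  have hm3 : 2 * m - (m - Real.pi / 2) = m + Real.pi / 2 := by ring
  simp only [Pi.sub_apply, mul_zero, intervalIntegral.integral_zero, add_zero, hm2, hm3,
    sub_self] at this
  exact sub_eq_zero.1 ((mul_eq_zero.1 this.symm).resolve_left (Complex.exp_ne_zero _))

/-- If `p` is odd, the origin is a center. -/
theorem IsSmallOrbit.periodic_of_odd {d : ℕ} {lam : ℕ → ℂ} {x : ℂ} {r : ℝ → ℂ}
    (h : IsSmallOrbit d lam x r) (hlam : ∑ i ∈ Finset.Icc 1 d, ‖lam i‖ ≤ 1)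
    (hodd : ∀ u, (damping d lam).eval (-u) = -(damping d lam).eval u) :
    r (2 * Real.pi) = x := by
  have hpi := Real.pi_pos
  -- The axes `π/2` and `3π/2` give `r 0 = r π` and `r π = r (2π)`.
  have h1 := h.eq_of_reflection hlam hodd (m := Real.pi / 2)
    (fun θ => by rw [mul_div_cancel₀ _ two_ne_zero, Real.cos_pi_sub])
    (fun θ => by rw [mul_div_cancel₀ _ two_ne_zero, Real.sin_pi_sub])
    (by linarith) (by linarith)
  have h3 : ∀ θ, 2 * (3 * Real.pi / 2) - θ = Real.pi - θ + 2 * Real.pi := fun θ => by ring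
  have h2 := h.eq_of_reflection hlam hodd (m := 3 * Real.pi / 2)
    (fun θ => by rw [h3, Real.cos_add_two_pi, Real.cos_pi_sub])
    (fun θ => by rw [h3, Real.sin_add_two_pi, Real.sin_pi_sub])
    (by linarith) (by linarith)
  rw [← h.start]
  convert (h1.trans (Eq.trans ?_ h2)).symm using 2
  · ring
  · ring
  · congr 1; ring

/-! ### Expansion of the displacement in the even coefficients. -/

/-- The coefficients of the odd part of `p`. -/
def oddCoeff (lam : ℕ → ℂ) (i : ℕ) : ℂ := if Even i then 0 else lam i

theorem sum_norm_oddCoeff_le (d : ℕ) (lam : ℕ → ℂ) :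
    ∑ i ∈ Finset.Icc 1 d, ‖oddCoeff lam i‖ ≤ ∑ i ∈ Finset.Icc 1 d, ‖lam i‖ := by
  refine Finset.sum_le_sum fun i _ => ?_
  rw [oddCoeff]
  split_ifs
  · simp
  · exact le_rfl

theorem eval_damping_oddCoeff_neg (d : ℕ) (lam : ℕ → ℂ) (u : ℂ) :
    (damping d (oddCoeff lam)).eval (-u) = -(damping d (oddCoeff lam)).eval u := by
  rw [eval_damping, eval_damping, ← Finset.sum_neg_distrib]
  refine Finset.sum_congr rfl fun i _ => ?_
  rw [oddCoeff]
  split_ifs with hi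
  · simp
  · rw [(Nat.not_even_iff_odd.1 hi).neg_pow, mul_neg]

theorem eval_damping_eq_add (d : ℕ) (lam : ℕ → ℂ) (u : ℂ) :
    (damping d lam).eval u = (damping d (oddCoeff lam)).eval u +
      ∑ k ∈ Finset.Icc 1 (d / 2), lam (2 * k) * u ^ (2 * k) := by
  have h : ∑ k ∈ Finset.Icc 1 (d / 2), lam (2 * k) * u ^ (2 * k) =
      ∑ i ∈ Finset.Icc 1 d with Even i, lam i * u ^ i := by
    refine Finset.sum_nbij' (fun k => 2 * k) (fun i => i / 2) ?_ ?_ ?_ ?_ ?_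
    · intro k hk
      simp only [Finset.mem_Icc, Finset.mem_filter] at hk ⊢
      exact ⟨by omega, even_two_mul k⟩
    · intro i hi
      simp only [Finset.mem_Icc, Finset.mem_filter] at hi ⊢
      obtain ⟨j, rfl⟩ := hi.2
      omega
    · intro k _; omega
    · intro i hi
      obtain ⟨j, rfl⟩ := (Finset.mem_filter.1 hi).2
      omega
    · intro k _; rfl
  rw [h, eval_damping, eval_damping, Finset.sum_filter, ← Finset.sum_add_distrib]
  refine Finset.sum_congr rfl fun i _ => ?_
  rw [oddCoeff]
  split_ifs <;> simp

theorem returnMap_oddCoeff {d : ℕ} {lam : ℕ → ℂ} (hlam : ∑ i ∈ Finset.Icc 1 d, ‖lam i‖ ≤ 1)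
    {x : ℂ} (hx : ‖x‖ ≤ 1 / 32) : returnMap d (oddCoeff lam) x = x := by
  have h0 := (sum_norm_oddCoeff_le d lam).trans hlam
  obtain ⟨r, hr⟩ := exists_isSmallOrbit h0 hx
  rw [hr.returnMap_eq h0]
  exact hr.periodic_of_odd h0 (eval_damping_oddCoeff_neg d lam)

theorem continuous_angularSpeed_comp (p : Polynomial ℂ) {r : ℝ → ℂ} (hr : Continuous r) :
    Continuous fun θ => angularSpeed p (r θ) θ := by
  have := p.continuous
  unfold angularSpeed
  fun_prop

/-- Here `|e^z - 1| ≤ 2|z| ≤ 304 M t`, `|1 - ab| ≤ 9t` and `|ab| ≥ 99/100`, and `313 / 0.99 < 330`.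
-/
theorem norm_exp_div_sub_one_le {z a b : ℂ} {M t : ℝ} (ht : t ≤ 1 / 4400) (hM : 1 ≤ M)
    (hMt : 152 * M * t ≤ 1) (hz : ‖z‖ ≤ 152 * M * t) (ha : ‖a - 1‖ ≤ 4 * t)
    (hb : ‖b - 1‖ ≤ 4 * t) : ‖Complex.exp z / (a * b) - 1‖ ≤ 330 * M * t := by
  have ht0 : 0 ≤ t := by linarith [norm_nonneg (a - 1)]
  have hab : ‖1 - a * b‖ ≤ 9 * t := by
    have : 1 - a * b = -((a - 1) + (b - 1) + (a - 1) * (b - 1)) := by ring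
    rw [this, norm_neg]
    refine norm_add₃_le.trans ?_
    rw [norm_mul]
    nlinarith [norm_nonneg (a - 1), norm_nonneg (b - 1)]
  have hab' : 99 / 100 ≤ ‖a * b‖ := by
    have := norm_sub_norm_le (1 : ℂ) (1 - a * b)
    rw [sub_sub_cancel, norm_one] at this
    linarith
  have hne : a * b ≠ 0 := by rw [← norm_pos_iff]; linarith
  have he := Complex.norm_exp_sub_one_le (hz.trans hMt)
  rw [div_sub_one hne, norm_div, div_le_iff₀ (by linarith)]
  have : Complex.exp z - a * b = (Complex.exp z - 1) + (1 - a * b) := by ring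
  rw [this]
  refine (norm_add_le _ _).trans ?_
  have h1 : t ≤ M * t := le_mul_of_one_le_left ht0 hM
  nlinarith [mul_nonneg (by linarith : (0 : ℝ) ≤ M) ht0]

/-- The displacement `P(x) - x` of the return map `P`, to leading order in `x` separately in each
coefficient of the even part of `p`. -/
theorem norm_returnMap_sub_le {d : ℕ} {lam : ℕ → ℂ} (hlam : ∑ i ∈ Finset.Icc 1 d, ‖lam i‖ ≤ 1)
    (hd : 1 ≤ d / 2) {x : ℂ} (hx : 2200 * ((d / 2 : ℕ) + 1) * ‖x‖ ≤ 1) :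
    ‖returnMap d lam x - x -
        ∑ k ∈ Finset.Icc 1 (d / 2), lam (2 * k) * (x ^ (2 * k + 1) * (wallisConst k : ℂ))‖ ≤
      2200 * ((d / 2 : ℕ) + 1) *
        ∑ k ∈ Finset.Icc 1 (d / 2), ‖lam (2 * k)‖ * ‖x‖ ^ (2 * k + 2) := by
  have hpi := Real.pi_lt_d2
  have hpi0 : (0 : ℝ) ≤ 2 * Real.pi := by positivity
  have hd' : (1 : ℝ) ≤ (d / 2 : ℕ) := by exact_mod_cast hd
  have hx0 := norm_nonneg x
  have hx1 : ‖x‖ ≤ 1 / 4400 := by nlinarith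
  set μ := oddCoeff lam with hμ
  have hlam0 : ∑ i ∈ Finset.Icc 1 d, ‖μ i‖ ≤ 1 := (sum_norm_oddCoeff_le d lam).trans hlam
  obtain ⟨r, hr⟩ := exists_isSmallOrbit hlam (show ‖x‖ ≤ 1 / 32 by linarith)
  obtain ⟨r₀, hr₀⟩ := exists_isSmallOrbit hlam0 (show ‖x‖ ≤ 1 / 32 by linarith)
  -- The difference of the two equations splits into the slope of the odd field between `r` and
  -- `r₀`, and the forcing `B`: the two fields compared at the same point `r θ`. Only even
  -- coefficients enter `B`.
  set A : ℝ → ℂ := fun θ => orbitSlope d μ (r θ) (r₀ θ) θ with hA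
  have hAc : Continuous A :=
    continuous_orbitSlope_comp hlam0 hr.continuous hr₀.continuous hr.norm_le hr₀.norm_le
  set D : ℝ → ℂ := fun θ =>
    angularSpeed (damping d lam) (r θ) θ * angularSpeed (damping d μ) (r θ) θ with hD
  have hD0 : ∀ θ, D θ ≠ 0 := fun θ => mul_ne_zero (angularSpeed_ne_zero hlam (hr.norm_le θ) θ)
    (angularSpeed_ne_zero hlam0 (hr.norm_le θ) θ)
  have hDc : Continuous D :=
    (continuous_angularSpeed_comp _ hr.continuous).mul (continuous_angularSpeed_comp _ hr.continuous)
  set b : ℕ → ℝ → ℂ := fun k θ =>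
    r θ ^ (2 * k + 1) * ((Real.cos θ ^ (2 * k) * Real.sin θ ^ 2 : ℝ) : ℂ) / D θ with hb
  have hbc : ∀ k, Continuous (b k) := fun k => by
    refine Continuous.div₀ ?_ hDc hD0
    have := hr.continuous
    fun_prop
  set B : ℝ → ℂ := fun θ => ∑ k ∈ Finset.Icc 1 (d / 2), lam (2 * k) * b k θ with hB
  have hBc : Continuous B := continuous_finsetSum _ fun k _ => (hbc k).const_mul _
  have hODE : ∀ θ ∈ Ioo 0 (2 * Real.pi),
      HasDerivAt (fun θ => r θ - r₀ θ) (A θ * (r θ - r₀ θ) + B θ) θ := by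
    intro θ hθ
    have hθ' := Ioo_subset_Icc_self hθ
    have hn := Icc_mem_nhds hθ.1 hθ.2
    refine (((hr.orbit θ hθ').hasDerivAt hn).fun_sub
      ((hr₀.orbit θ hθ').hasDerivAt hn)).congr_deriv ?_
    have h1 := angularSpeed_ne_zero hlam (hr.norm_le θ) θ
    have h2 := angularSpeed_ne_zero hlam0 (hr.norm_le θ) θ
    have h3 := angularSpeed_ne_zero hlam0 (hr₀.norm_le θ) θ
    have hBθ : B θ = r θ * (Real.sin θ : ℂ) ^ 2 *
        (∑ k ∈ Finset.Icc 1 (d / 2), lam (2 * k) * (r θ * (Real.cos θ : ℂ)) ^ (2 * k)) / D θ := by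
      rw [hB, Finset.mul_sum, Finset.sum_div]
      refine Finset.sum_congr rfl fun k _ => ?_
      simp only [hb]
      push_cast
      ring
    have hBθ' : B θ = radialSpeed (damping d lam) (r θ) θ / angularSpeed (damping d lam) (r θ) θ -
        radialSpeed (damping d μ) (r θ) θ / angularSpeed (damping d μ) (r θ) θ := by
      rw [hBθ, div_sub_div _ _ h1 h2]
      congr 1
      have := eval_damping_eq_add d lam (r θ * (Real.cos θ : ℂ))
      simp only [radialSpeed, angularSpeed]
      rw [this]
      ring
    rw [hA, orbitSlope_mul_sub h2 h3, hBθ']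
    ring
  have hsol := linear_ode_solution hpi0 hAc hBc (hr.continuous.fun_sub hr₀.continuous).continuousOn hODE
  simp only [hr.start, hr₀.start, sub_self, zero_add] at hsol
  set E : ℝ → ℂ := fun s => Complex.exp (∫ u in s..2 * Real.pi, A u) with hE
  have hEc : Continuous E := by
    refine Complex.continuous_exp.comp ?_
    have : (fun s => ∫ u in s..2 * Real.pi, A u) = fun s => -∫ u in (2 * Real.pi)..s, A u :=
      funext fun s => intervalIntegral.integral_symm _ _
    rw [this]
    exact (intervalIntegral.continuous_primitive (fun _ _ => hAc.intervalIntegrable _ _) _).neg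
  -- The odd comparison orbit returns to `x`, so the displacement is the solution `r - r₀` at `2π`.
  have hdisp : returnMap d lam x - x = ∑ k ∈ Finset.Icc 1 (d / 2),
      lam (2 * k) * ∫ s in (0 : ℝ)..2 * Real.pi, E s * b k s := by
    have h1 : returnMap d lam x - x = r (2 * Real.pi) - r₀ (2 * Real.pi) := by
      rw [hr.returnMap_eq hlam, ← hr₀.returnMap_eq hlam0,
        returnMap_oddCoeff hlam (by linarith)]
    rw [h1, hsol, ← intervalIntegral.integral_const_mul]
    simp_rw [← intervalIntegral.integral_const_mul]
    have hEb : ∀ k, Continuous fun s => lam (2 * k) * (E s * b k s) :=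
      fun k => (hEc.mul (hbc k)).const_mul _
    rw [← intervalIntegral.integral_finsetSum fun k _ => (hEb k).intervalIntegrable _ _]
    refine intervalIntegral.integral_congr fun s _ => ?_
    have h2 : (∫ u in (0 : ℝ)..2 * Real.pi, A u) + -(∫ u in (0 : ℝ)..s, A u) =
        ∫ u in s..2 * Real.pi, A u := by
      rw [← sub_eq_add_neg, intervalIntegral.integral_interval_sub_left] <;>
        exact hAc.intervalIntegrable _ _
    simp only [hE, hB]
    rw [← mul_assoc, ← Complex.exp_add, h2, Finset.mul_sum]
    exact Finset.sum_congr rfl fun k _ => by ring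
  rw [hdisp, ← Finset.sum_sub_distrib, Finset.mul_sum]
  refine norm_sum_le_of_le _ fun k hk => ?_
  have hk' : (k : ℝ) ≤ (d / 2 : ℕ) := by exact_mod_cast (Finset.mem_Icc.1 hk).2
  have hk0 : (0 : ℝ) ≤ k := k.cast_nonneg
  have hkx : (k + 1) * ‖x‖ ≤ ((d / 2 : ℕ) + 1) * ‖x‖ := by gcongr
  have hpt : ∀ s ∈ uIoc 0 (2 * Real.pi), ‖E s * b k s -
      x ^ (2 * k + 1) * ((Real.cos s ^ (2 * k) * Real.sin s ^ 2 : ℝ) : ℂ)‖ ≤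
        ‖x‖ ^ (2 * k + 1) * (330 * (k + 1) * ‖x‖) := by
    intro s hs
    have hs' : s ∈ Icc 0 (2 * Real.pi) := Ioc_subset_Icc_self (by rwa [uIoc_of_le hpi0] at hs)
    have h0 : (0 : ℝ) ∈ Icc 0 (2 * Real.pi) := ⟨le_rfl, hpi0⟩
    have h2 : 2 * Real.pi ∈ Icc 0 (2 * Real.pi) := ⟨hpi0, le_rfl⟩
    set α := ∫ u in (0 : ℝ)..s, orbitSlope d lam (r u) 0 u with hα
    have hrs : r s = Complex.exp α * x := by
      simpa using hr.sub_eq (isSmallOrbit_zero d lam) hlam hs'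
    have hαn : ‖α‖ ≤ 76 * ‖x‖ := by
      refine (intervalIntegral.norm_integral_le_of_norm_le_const fun u hu =>
        norm_orbitSlope_le hlam (by linarith : 4 * ‖x‖ ≤ 1 / 16) (hr.norm_le_mul hlam ?_)
          (norm_zero.trans_le (by positivity)) u).trans ?_
      · rw [uIoc_of_le hs'.1] at hu
        exact ⟨hu.1.le, hu.2.trans hs'.2⟩
      · rw [sub_zero, abs_of_nonneg hs'.1]
        nlinarith [hs'.2]
    have hβn : ‖∫ u in s..2 * Real.pi, A u‖ ≤ 76 * ‖x‖ :=
      hr.norm_integral_orbitSlope_le_mul hr₀ hlam hlam0 (by linarith) hs' h2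
    -- Since `r s = exp α * x`, the power `r^(2k+1)` contributes `(2k+1) α` to the exponent; the
    -- total is `76 (1 + (2k+1)) = 152 (k+1)`.
    have hz : ‖(∫ u in s..2 * Real.pi, A u) + (2 * k + 1 : ℕ) * α‖ ≤ 152 * (k + 1) * ‖x‖ := by
      refine (norm_add_le _ _).trans ?_
      rw [norm_mul, Complex.norm_natCast]
      push_cast
      nlinarith
    have h4 : 4 * ‖x‖ ≤ 1 := by linarith
    have hexp := norm_exp_div_sub_one_le hx1 (M := k + 1) (by linarith) (by nlinarith) hz
      (norm_angularSpeed_sub_one_le hlam h4 (hr.norm_le_mul hlam hs') s)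
      (norm_angularSpeed_sub_one_le hlam0 h4 (hr.norm_le_mul hlam hs') s)
    have heq : E s * b k s -
        x ^ (2 * k + 1) * ((Real.cos s ^ (2 * k) * Real.sin s ^ 2 : ℝ) : ℂ) =
        x ^ (2 * k + 1) * ((Real.cos s ^ (2 * k) * Real.sin s ^ 2 : ℝ) : ℂ) *
          (Complex.exp ((∫ u in s..2 * Real.pi, A u) + (2 * k + 1 : ℕ) * α) / D s - 1) := by
      simp only [hE, hb]
      rw [hrs, mul_pow, Complex.exp_add, Complex.exp_nat_mul]
      ring
    have hw : ‖((Real.cos s ^ (2 * k) * Real.sin s ^ 2 : ℝ) : ℂ)‖ ≤ 1 := by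
      rw [Complex.norm_real, norm_mul, norm_pow, norm_pow]
      exact mul_le_one₀ (pow_le_one₀ (norm_nonneg _) (Real.abs_cos_le_one s)) (by positivity)
        (pow_le_one₀ (norm_nonneg _) (Real.abs_sin_le_one s))
    rw [heq, norm_mul, norm_mul, norm_pow]
    calc _ ≤ ‖x‖ ^ (2 * k + 1) * 1 * (330 * (k + 1) * ‖x‖) := by gcongr
      _ = _ := by ring
  have hint : (∫ s in (0 : ℝ)..2 * Real.pi, E s * b k s) - x ^ (2 * k + 1) * (wallisConst k : ℂ) =
      ∫ s in (0 : ℝ)..2 * Real.pi, (E s * b k s -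
        x ^ (2 * k + 1) * ((Real.cos s ^ (2 * k) * Real.sin s ^ 2 : ℝ) : ℂ)) := by
    rw [intervalIntegral.integral_sub, intervalIntegral.integral_const_mul,
      intervalIntegral.integral_ofReal, wallisConst]
    · exact (hEc.mul (hbc k)).intervalIntegrable _ _
    · exact Continuous.intervalIntegrable (by fun_prop) _ _
  rw [← mul_sub, norm_mul, hint]
  calc _ ≤ ‖lam (2 * k)‖ * (‖x‖ ^ (2 * k + 1) * (330 * (k + 1) * ‖x‖) * |2 * Real.pi - 0|) := by
        gcongr
        exact intervalIntegral.norm_integral_le_of_norm_le_const hpt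
    _ = (660 * Real.pi * (k + 1)) * (‖lam (2 * k)‖ * ‖x‖ ^ (2 * k + 2)) := by
        rw [sub_zero, abs_of_nonneg hpi0]; ring
    -- The constant `2200` exceeds `660π`.
    _ ≤ _ := by
        gcongr
        linarith

/-! ### Holomorphic functions with many zeros near the origin. -/

theorem iteratedDeriv_polynomial_eval (P : Polynomial ℂ) (j : ℕ) :
    iteratedDeriv j (fun x => P.eval x) = fun x => (Polynomial.derivative^[j] P).eval x := by
  induction j with
  | zero => simp
  | succ j ih =>
    ext x
    rw [iteratedDeriv_succ, ih, Function.iterate_succ_apply', Polynomial.deriv]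

/-- Cauchy's estimate for the coefficients of a polynomial. -/
theorem norm_coeff_mul_pow_le {P : Polynomial ℂ} {R M : ℝ} (hR : 0 < R)
    (h : ∀ x, ‖x‖ = R → ‖P.eval x‖ ≤ M) (j : ℕ) : ‖P.coeff j‖ * R ^ j ≤ M := by
  have := Complex.norm_iteratedDeriv_le_of_forall_mem_sphere_norm_le (f := fun x => P.eval x)
    (c := 0) j hR P.differentiable.diffContOnCl fun x hx => h x (mem_sphere_zero_iff_norm.1 hx)
  rw [iteratedDeriv_polynomial_eval] at this
  simp only [← Polynomial.coeff_zero_eq_eval_zero, Polynomial.coeff_iterate_derivative, zero_add,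
    Nat.descFactorial_self, nsmul_eq_mul, norm_mul, Complex.norm_natCast] at this
  rw [mul_div_assoc] at this
  rw [← le_div_iff₀ (by positivity)]
  exact le_of_mul_le_mul_left this (by positivity)

/-- Zeros are divided out one at a time by `dslope`, which stays holomorphic at the removed zero. -/
theorem exists_eq_prod_mul {G : ℂ → ℂ} {T : ℝ} (hG : DifferentiableOn ℂ G (Metric.ball 0 T))
    (Z : Finset ℂ) (hZ : ∀ z ∈ Z, z ∈ Metric.ball (0 : ℂ) T ∧ G z = 0) :
    ∃ H : ℂ → ℂ, DifferentiableOn ℂ H (Metric.ball 0 T) ∧ ∀ x, G x = (∏ z ∈ Z, (x - z)) * H x := by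
  classical
  induction Z using Finset.induction_on with
  | empty => exact ⟨G, hG, by simp⟩
  | insert a Z ha ih =>
    obtain ⟨H, hH, hGH⟩ := ih fun z hz => hZ z (Finset.mem_insert_of_mem hz)
    obtain ⟨haT, haG⟩ := hZ a (Finset.mem_insert_self a Z)
    have hHa : H a = 0 := by
      refine (mul_eq_zero.1 ((hGH a).symm.trans haG)).resolve_left ?_
      exact Finset.prod_ne_zero_iff.2 fun z hz => sub_ne_zero.2 fun h => ha (h ▸ hz)
    refine ⟨dslope H a,
      (Complex.differentiableOn_dslope (Metric.isOpen_ball.mem_nhds haT)).2 hH, fun x => ?_⟩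
    have := sub_smul_dslope H a x
    rw [hHa, sub_zero, smul_eq_mul] at this
    rw [hGH, ← this, Finset.prod_insert ha]
    ring

/-- A holomorphic function with many zeros near the center of a disc is small there. -/
theorem norm_le_of_zeros {G : ℂ → ℂ} {S T ε M : ℝ} (hG : DifferentiableOn ℂ G (Metric.ball 0 T))
    (hST : S < T) (hS : 0 < S) (hε : 0 < ε) (hεS : 3 * ε ≤ S) (hM : ∀ x, ‖x‖ = S → ‖G x‖ ≤ M)
    (Z : Finset ℂ) (hZ : ∀ z ∈ Z, ‖z‖ < ε ∧ G z = 0) {x : ℂ} (hx : ‖x‖ ≤ ε) :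
    ‖G x‖ ≤ (3 * ε / S) ^ Z.card * M := by
  obtain ⟨H, hH, hGH⟩ := exists_eq_prod_mul hG Z fun z hz =>
    ⟨mem_ball_zero_iff.2 (by linarith [(hZ z hz).1]), (hZ z hz).2⟩
  have hM0 : 0 ≤ M := (norm_nonneg _).trans (hM (S : ℂ) (by simp [abs_of_pos hS]))
  -- Maximum principle for the quotient: on `|y| = S` each factor satisfies `|y - z| ≥ S - ε ≥
  -- 2S/3`, whereas `|x - z| ≤ 2ε` inside.
  have hHx : ‖H x‖ ≤ M / (2 * S / 3) ^ Z.card := by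
    refine Complex.norm_le_of_forall_mem_frontier_norm_le (U := Metric.ball (0 : ℂ) S)
      Metric.isBounded_ball ?_ (fun y hy => ?_) ?_
    · refine (hH.mono ?_).diffContOnCl
      rw [closure_ball _ hS.ne']
      exact Metric.closedBall_subset_ball hST
    · rw [frontier_ball _ hS.ne', mem_sphere_zero_iff_norm] at hy
      have h1 := hM y hy
      rw [hGH, norm_mul] at h1
      have h2 : (2 * S / 3) ^ Z.card ≤ ‖∏ z ∈ Z, (y - z)‖ := by
        rw [norm_prod, ← Finset.prod_const]
        refine Finset.prod_le_prod (fun _ _ => by positivity) fun z hz => ?_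
        have := norm_sub_norm_le y z
        linarith [(hZ z hz).1]
      rw [le_div_iff₀ (by positivity)]
      refine le_trans ?_ h1
      rw [mul_comm]
      gcongr
    · rw [closure_ball _ hS.ne', mem_closedBall_zero_iff]
      linarith
  have hprod : ‖∏ z ∈ Z, (x - z)‖ ≤ (2 * ε) ^ Z.card := by
    rw [norm_prod, ← Finset.prod_const]
    refine Finset.prod_le_prod (fun _ _ => norm_nonneg _) fun z hz => ?_
    have := norm_sub_le x z
    linarith [(hZ z hz).1]
  rw [hGH, norm_mul]
  calc _ ≤ (2 * ε) ^ Z.card * (M / (2 * S / 3) ^ Z.card) := by gcongr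
    _ = (2 * ε / (2 * S / 3)) ^ Z.card * M := by rw [div_pow (2 * ε)]; ring
    _ = _ := by congr 2; field_simp

/-- Suppose that a holomorphic function `G` is close to an even polynomial of degree `2n - 2`, with
an error controlled separately by each coefficient. If `G` has `2n` zeros sufficiently close to the
origin then all the coefficients vanish. -/
theorem coeff_eq_zero_of_zeros {G : ℂ → ℂ} {n : ℕ} {μ : ℕ → ℂ} {w : ℕ → ℝ} {c C S T ε : ℝ}
    (hn : 1 ≤ n) (hc : 0 < c) (hcw : ∀ k < n, c ≤ w k) (hw1 : ∀ k < n, w k ≤ 1)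
    (hG : DifferentiableOn ℂ G (Metric.ball 0 T)) (hST : S < T) (hS : 0 < S)
    (hC : 0 ≤ C) (hCS : C * S ≤ 1)
    (happ : ∀ x, x ≠ 0 → ‖x‖ < T → ‖G x - ∑ k ∈ Finset.range n, μ k * (x ^ (2 * k) * (w k : ℂ))‖ ≤
      C * ∑ k ∈ Finset.range n, ‖μ k‖ * ‖x‖ ^ (2 * k + 1))
    (hε : 0 < ε) (hεS : ε ≤ S * (c ^ n / 16 ^ n)) (Z : Finset ℂ) (hcard : Z.card = 2 * n)
    (hZ : ∀ z ∈ Z, ‖z‖ < ε ∧ G z = 0) : ∀ k < n, μ k = 0 := by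
  have hc1 : c ≤ 1 := (hcw 0 hn).trans (hw1 0 hn)
  have hcn : c ^ n ≤ c := pow_le_of_le_one hc.le hc1 (by omega)
  have h16 : (16 : ℝ) ≤ 16 ^ n := by simpa using pow_le_pow_right₀ (by norm_num : (1 : ℝ) ≤ 16) hn
  -- Only this weaker bound, with `c` in place of `c ^ n`, is needed below.
  have hεc : ε ≤ S * (c / 16 ^ n) := hεS.trans (by gcongr)
  have hε3 : 3 * ε ≤ S := by
    have : c / 16 ^ n ≤ 1 / 16 := by gcongr
    nlinarith
  have hεS1 : ε ≤ S := by linarith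
  -- The dominant term on `|x| = ε`; every estimate is made relative to its size `m`.
  obtain ⟨k₀, hk₀, hmax⟩ := Finset.exists_max_image (Finset.range n) (fun k => ‖μ k‖ * ε ^ (2 * k))
    ⟨0, Finset.mem_range.2 hn⟩
  set m := ‖μ k₀‖ * ε ^ (2 * k₀) with hm
  have hm0 : 0 ≤ m := by positivity
  have hwn : ∀ k < n, ‖(w k : ℂ)‖ ≤ 1 := fun k hk => by
    rw [Complex.norm_real, Real.norm_of_nonneg (hc.le.trans (hcw k hk))]; exact hw1 k hk
  have hGS : ∀ x, ‖x‖ = S → ‖G x‖ ≤ 2 * n * m * (S / ε) ^ (2 * n - 2) := by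
    intro x hx
    have hx0 : x ≠ 0 := norm_pos_iff.1 (hx ▸ hS)
    have h1 := happ x hx0 (hx ▸ hST)
    have h2 := norm_le_norm_sub_add (G x) (∑ k ∈ Finset.range n, μ k * (x ^ (2 * k) * (w k : ℂ)))
    have hterm : ∀ k ∈ Finset.range n, ‖μ k‖ * S ^ (2 * k) ≤ m * (S / ε) ^ (2 * n - 2) := by
      intro k hk
      have hkn := Finset.mem_range.1 hk
      calc ‖μ k‖ * S ^ (2 * k) = ‖μ k‖ * ε ^ (2 * k) * (S / ε) ^ (2 * k) := by
            rw [mul_assoc, ← mul_pow, mul_div_cancel₀ _ hε.ne']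
        _ ≤ m * (S / ε) ^ (2 * n - 2) := by
            gcongr
            · exact hmax k hk
            · rwa [one_le_div hε]
            · omega
    have h3 : ‖∑ k ∈ Finset.range n, μ k * (x ^ (2 * k) * (w k : ℂ))‖ ≤
        ∑ k ∈ Finset.range n, ‖μ k‖ * S ^ (2 * k) := by
      refine norm_sum_le_of_le _ fun k hk => ?_
      rw [norm_mul, norm_mul, norm_pow, hx]
      gcongr
      exact mul_le_of_le_one_right (by positivity) (hwn k (Finset.mem_range.1 hk))
    have h4 : C * ∑ k ∈ Finset.range n, ‖μ k‖ * ‖x‖ ^ (2 * k + 1) ≤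
        ∑ k ∈ Finset.range n, ‖μ k‖ * S ^ (2 * k) := by
      have : C * ∑ k ∈ Finset.range n, ‖μ k‖ * ‖x‖ ^ (2 * k + 1) =
          C * S * ∑ k ∈ Finset.range n, ‖μ k‖ * S ^ (2 * k) := by
        rw [hx, Finset.mul_sum, Finset.mul_sum]
        exact Finset.sum_congr rfl fun k _ => by ring
      rw [this]
      exact mul_le_of_le_one_left (Finset.sum_nonneg fun k _ => by positivity) hCS
    have h5 := Finset.sum_le_card_nsmul _ _ _ hterm
    rw [Finset.card_range, nsmul_eq_mul] at h5
    linarith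
  -- The `2n` zeros beat the growth exponent `2n - 2` by `(ε/S)² ≤ (c/16^n)²`, which absorbs `9^n`
  -- and `n ≤ 2^n`; one factor `c` is kept to compare with `w k₀`.
  have hsmall : ∀ x, ‖x‖ = ε → ‖G x‖ ≤ m * c * (2 * 18 ^ n / 256 ^ n) := by
    intro x hx
    refine (norm_le_of_zeros hG hST hS hε hε3 hGS Z hZ hx.le).trans ?_
    have h1 : (3 * ε / S) ^ Z.card * (2 * n * m * (S / ε) ^ (2 * n - 2)) =
        2 * n * 9 ^ n * m * (ε / S) ^ 2 := by
      obtain ⟨j, rfl⟩ : ∃ j, n = j + 1 := ⟨n - 1, by omega⟩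
      have h2 : (ε / S) ^ (2 * j) * (S / ε) ^ (2 * j) = 1 := by
        rw [← mul_pow, div_mul_div_cancel₀ hS.ne', div_self hε.ne', one_pow]
      have h3 : (9 : ℝ) ^ (j + 1) = 3 ^ (2 * (j + 1)) := by rw [pow_mul]; norm_num
      rw [hcard, show 2 * (j + 1) - 2 = 2 * j by omega, mul_div_assoc, mul_pow, h3,
        show 2 * (j + 1) = 2 * j + 2 by ring, pow_add (ε / S)]
      linear_combination (3 ^ (2 * j + 2) * (ε / S) ^ 2 * (2 * ((j + 1 : ℕ) : ℝ) * m)) * h2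
    have h2 : ε / S ≤ c / 16 ^ n := by rw [div_le_iff₀ hS, mul_comm]; exact hεc
    have h3 : (n : ℝ) ≤ 2 ^ n := by exact_mod_cast Nat.lt_two_pow_self.le
    rw [h1]
    calc _ ≤ 2 * 2 ^ n * 9 ^ n * m * (c / 16 ^ n) ^ 2 := by gcongr
      _ = m * (c * c) * (2 * (2 * 9) ^ n / (16 ^ 2) ^ n) := by
          rw [mul_pow, ← pow_mul (16 : ℝ), mul_comm 2 n, pow_mul]; ring
      _ ≤ m * (c * 1) * (2 * (2 * 9) ^ n / (16 ^ 2) ^ n) := by gcongr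
      _ = _ := by norm_num
  have h18 : (2 * 18 ^ n / 256 ^ n : ℝ) ≤ 1 / 4 := by
    have h1 : (18 / 256 : ℝ) ^ n ≤ 18 / 256 := pow_le_of_le_one (by norm_num) (by norm_num) (by omega)
    rw [mul_div_assoc, ← div_pow]
    linarith
  set Q : Polynomial ℂ := ∑ k ∈ Finset.range n,
    Polynomial.C (μ k * (w k : ℂ)) * Polynomial.X ^ (2 * k) with hQ
  have hQe : ∀ x, ‖x‖ = ε → ‖Q.eval x‖ ≤ m * c * (1 / 2) := by
    intro x hx
    have hx0 : x ≠ 0 := norm_pos_iff.1 (hx ▸ hε)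
    have hQx : Q.eval x = ∑ k ∈ Finset.range n, μ k * (x ^ (2 * k) * (w k : ℂ)) := by
      rw [hQ, Polynomial.eval_finsetSum]
      refine Finset.sum_congr rfl fun k _ => ?_
      simp only [Polynomial.eval_mul, Polynomial.eval_C, Polynomial.eval_pow, Polynomial.eval_X]
      ring
    have h1 := happ x hx0 (by rw [hx]; linarith)
    have h2 := norm_sub_le (G x) (G x - Q.eval x)
    rw [sub_sub_cancel, hQx] at h2
    have h3 : C * ∑ k ∈ Finset.range n, ‖μ k‖ * ‖x‖ ^ (2 * k + 1) ≤ m * c * (1 / 8) := by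
      have h4 : ∑ k ∈ Finset.range n, ‖μ k‖ * ‖x‖ ^ (2 * k + 1) ≤ n * (m * ε) := by
        have h5 := Finset.sum_le_card_nsmul (Finset.range n) (fun k => ‖μ k‖ * ‖x‖ ^ (2 * k + 1))
          (m * ε) fun k hk => by
            rw [hx, pow_succ, ← mul_assoc]
            gcongr
            exact hmax k hk
        rwa [Finset.card_range, nsmul_eq_mul] at h5
      have h5 : n * (C * ε) ≤ c * (1 / 8) := by
        have h6 : (n : ℝ) ≤ 2 ^ n := by exact_mod_cast Nat.lt_two_pow_self.le
        have h7 : (2 / 16 : ℝ) ^ n ≤ 2 / 16 :=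
          pow_le_of_le_one (by norm_num) (by norm_num) (by omega)
        calc n * (C * ε) ≤ 2 ^ n * (C * (S * (c / 16 ^ n))) := by gcongr
          _ = C * S * c * (2 / 16) ^ n := by rw [div_pow]; ring
          _ ≤ 1 * c * (2 / 16) := by gcongr
          _ = _ := by norm_num
      calc _ ≤ C * (n * (m * ε)) := by gcongr
        _ = m * (n * (C * ε)) := by ring
        _ ≤ m * (c * (1 / 8)) := by gcongr
        _ = _ := by ring
    have h4 := hsmall x hx
    have h5 : m * c * (2 * 18 ^ n / 256 ^ n) ≤ m * c * (1 / 4) := by gcongr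
    have h6 : 0 ≤ m * c := by positivity
    rw [hQx]
    linarith
  have hcoeff : Q.coeff (2 * k₀) = μ k₀ * (w k₀ : ℂ) := by
    simp only [hQ, Polynomial.finsetSum_coeff, Polynomial.coeff_C_mul, Polynomial.coeff_X_pow]
    rw [Finset.sum_eq_single k₀]
    · simp
    · intro k _ hk
      rw [if_neg (by omega), mul_zero]
    · exact fun h => absurd hk₀ h
  -- Cauchy's estimate gives `m * w k₀ ≤ m * c / 2`; as `w k₀ ≥ c > 0`, this forces `m = 0`.
  have hkey := norm_coeff_mul_pow_le hε hQe (2 * k₀)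
  have hk₀n := Finset.mem_range.1 hk₀
  have hw0 := hcw k₀ hk₀n
  rw [hcoeff, norm_mul, Complex.norm_real, Real.norm_of_nonneg (hc.le.trans hw0)] at hkey
  have hm' : m = 0 := by
    have : m * c ≤ m * (w k₀) := by gcongr
    have h1 : ‖μ k₀‖ * w k₀ * ε ^ (2 * k₀) = m * w k₀ := by rw [hm]; ring
    nlinarith
  intro k hk
  have h1 : ‖μ k‖ * ε ^ (2 * k) ≤ 0 := (hmax k (Finset.mem_range.2 hk)).trans hm'.le
  have h2 : ‖μ k‖ ≤ 0 := by
    by_contra h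
    push Not at h
    have : 0 < ‖μ k‖ * ε ^ (2 * k) := by positivity
    linarith
  exact norm_le_zero_iff.1 h2

/-! ### The Wallis constants. -/

theorem continuous_wallis_integrand (n : ℕ) :
    Continuous fun θ : ℝ => Real.cos θ ^ (2 * n) * Real.sin θ ^ 2 := by fun_prop

theorem wallisConst_pos (n : ℕ) : 0 < wallisConst n := by
  have hpi := Real.pi_pos
  refine intervalIntegral.integral_pos (by positivity)
    (continuous_wallis_integrand n).continuousOn (fun θ _ => ?_)
    ⟨Real.pi / 4, ⟨by positivity, by linarith⟩, ?_⟩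
  · exact mul_nonneg (Even.pow_nonneg (even_two_mul n) _) (sq_nonneg _)
  · rw [Real.cos_pi_div_four, Real.sin_pi_div_four]
    positivity

theorem wallisConst_antitone {k n : ℕ} (h : k ≤ n) : wallisConst n ≤ wallisConst k := by
  refine intervalIntegral.integral_mono_on (by positivity)
    ((continuous_wallis_integrand n).intervalIntegrable _ _)
    ((continuous_wallis_integrand k).intervalIntegrable _ _) fun θ _ => ?_
  rw [pow_mul, pow_mul]
  exact mul_le_mul_of_nonneg_right
    (pow_le_pow_of_le_one (sq_nonneg _) (Real.cos_sq_le_one θ) h) (sq_nonneg _)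

/-- Monotonicity reduces to `wallisConst 1 = π/4`. -/
theorem wallisConst_le_one {n : ℕ} (hn : 1 ≤ n) : wallisConst n ≤ 1 := by
  refine (wallisConst_antitone hn).trans ?_
  have h1 : wallisConst 1 = Real.pi / 4 := by
    have h2 : wallisConst 1 = ∫ θ in (0 : ℝ)..2 * Real.pi, Real.sin θ ^ 2 * Real.cos θ ^ 2 :=
      intervalIntegral.integral_congr fun θ _ => by ring_nf
    have h3 : 4 * (2 * Real.pi) = (8 : ℕ) * Real.pi := by push_cast; ring
    rw [h2, integral_sin_sq_mul_cos_sq, h3, Real.sin_nat_mul_pi]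
    simp
    ring
  rw [h1]
  linarith [Real.pi_lt_d2]

/-! ### Rescaling and the weight `ρ`. -/

theorem ReturnsTo.scale {p q : Polynomial ℂ} {c : ℂ} (hpq : ∀ u, q.eval u = p.eval (c * u))
    {x y : ℂ} (h : ReturnsTo q x y) : ReturnsTo p (c * x) (c * y) := by
  obtain ⟨r, hr, rfl, rfl⟩ := h
  have ha : ∀ θ, angularSpeed p (c * r θ) θ = angularSpeed q (r θ) θ := fun θ => by
    rw [angularSpeed, angularSpeed, hpq, mul_assoc c]
  refine ⟨fun θ => c * r θ, ⟨fun θ hθ => ?_, fun θ hθ => ?_⟩, rfl, rfl⟩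
  · rw [ha]
    exact hr.regular θ hθ
  · refine ((hr.orbit θ hθ).const_mul c).congr_deriv ?_
    rw [ha, radialSpeed, radialSpeed, hpq, mul_assoc c]
    ring_nf

theorem eval_damping_scale (d : ℕ) (lam : ℕ → ℂ) (c u : ℂ) :
    (damping d fun i => c ^ i * lam i).eval u = (damping d lam).eval (c * u) := by
  rw [eval_damping, eval_damping]
  exact Finset.sum_congr rfl fun i _ => by rw [mul_pow]; ring

theorem returnsTo_scale_iff (d : ℕ) (lam : ℕ → ℂ) {c : ℂ} (hc : c ≠ 0) (x y : ℂ) :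
    ReturnsTo (damping d lam) x y ↔
      ReturnsTo (damping d fun i => c ^ i * lam i) (c⁻¹ * x) (c⁻¹ * y) := by
  constructor
  · exact fun h => h.scale fun u => by rw [eval_damping_scale, mul_inv_cancel_left₀ hc]
  · intro h
    have := h.scale (eval_damping_scale d lam c)
    rwa [mul_inv_cancel_left₀ hc, mul_inv_cancel_left₀ hc] at this

theorem existsUnique_weight_eq_one {d : ℕ} {lam : ℕ → ℂ}
    (hlam : ∃ i ∈ Finset.Icc 1 d, lam i ≠ 0) :
    ∃! ρ : ℝ, 0 < ρ ∧ ∑ i ∈ Finset.Icc 1 d, ρ ^ i * ‖lam i‖ = 1 := by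
  obtain ⟨i₀, hi₀, hne⟩ := hlam
  have hpos : 0 < ‖lam i₀‖ := norm_pos_iff.2 hne
  set g : ℝ → ℝ := fun ρ => ∑ i ∈ Finset.Icc 1 d, ρ ^ i * ‖lam i‖ with hg
  have hgc : Continuous g := by fun_prop
  have hmono : ∀ a b : ℝ, 0 < a → a < b → g a < g b := by
    intro a b ha hab
    refine Finset.sum_lt_sum (fun i _ => by gcongr) ⟨i₀, hi₀, ?_⟩
    have : i₀ ≠ 0 := by have := Finset.mem_Icc.1 hi₀; omega
    gcongr
  have hg0 : g 0 = 0 := Finset.sum_eq_zero fun i hi => by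
    have : i ≠ 0 := by have := Finset.mem_Icc.1 hi; omega
    rw [zero_pow this, zero_mul]
  -- Since `M ≥ 1`, already `M ^ i₀ * ‖lam i₀‖ ≥ M * ‖lam i₀‖ ≥ 1`.
  set M : ℝ := 1 + ‖lam i₀‖⁻¹ with hM
  have hM1 : 1 ≤ M := by rw [hM]; linarith [inv_pos.2 hpos]
  have hgM : 1 ≤ g M := by
    calc (1 : ℝ) = ‖lam i₀‖⁻¹ * ‖lam i₀‖ := (inv_mul_cancel₀ hpos.ne').symm
      _ ≤ M ^ i₀ * ‖lam i₀‖ := by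
          gcongr
          have h1 : M ≤ M ^ i₀ := le_self_pow₀ hM1 (by have := Finset.mem_Icc.1 hi₀; omega)
          linarith
      _ ≤ g M := Finset.single_le_sum (f := fun i => M ^ i * ‖lam i‖)
          (fun i _ => by positivity) hi₀
  obtain ⟨ρ, hρ, hgρ⟩ := intermediate_value_Icc (by linarith : (0 : ℝ) ≤ M) hgc.continuousOn
    (⟨by rw [hg0]; exact zero_le_one, hgM⟩ : (1 : ℝ) ∈ Icc (g 0) (g M))
  have hρ0 : ρ ≠ 0 := by
    rintro rfl
    rw [hg0] at hgρ
    exact zero_ne_one hgρ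
  refine ⟨ρ, ⟨hρ.1.lt_of_ne' hρ0, hgρ⟩, ?_⟩
  rintro σ ⟨hσ, hgσ⟩
  change g σ = 1 at hgσ
  rcases lt_trichotomy σ ρ with h | h | h
  · have := hmono _ _ hσ h; linarith
  · exact h
  · have := hmono _ _ (hρ.1.lt_of_ne' hρ0) h; linarith

/-! ### Too many fixed points force `p` to be odd. -/

/-- Places the circle of radius `S = 1 / (8 · 2^(10n))` inside the disc where the displacement
expansion is valid. -/
theorem pow_bound {n : ℕ} (hn : 1 ≤ n) : 2200 * ((n : ℝ) + 1) < 8 * 2 ^ (10 * n) := by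
  have h1 : (n : ℝ) + 1 ≤ 2 ^ n := by exact_mod_cast Nat.lt_two_pow_self (n := n)
  have h2 : (512 : ℝ) ≤ 512 ^ n := le_self_pow₀ (by norm_num) (by omega)
  have h3 : (2 : ℝ) ^ (10 * n) = 2 ^ n * 512 ^ n := by
    rw [pow_mul, ← mul_pow]; norm_num
  have h4 : (0 : ℝ) < 2 ^ n := by positivity
  rw [h3]
  nlinarith

/-- If the return map has `2n` nonzero fixed points close enough to the origin, then `p` is odd. -/
theorem even_coeff_eq_zero_of_fixed_points {d : ℕ} {lam : ℕ → ℂ}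
    (hlam : ∑ i ∈ Finset.Icc 1 d, ‖lam i‖ ≤ 1) (hd : 1 ≤ d / 2) {ε : ℝ} (hε : 0 < ε)
    (hεS : ε ≤ 1 / (8 * 2 ^ (10 * (d / 2))) * (wallisConst (d / 2) ^ (d / 2) / 16 ^ (d / 2)))
    (Z : Finset ℂ) (hcard : Z.card = 2 * (d / 2))
    (hZ : ∀ z ∈ Z, ‖z‖ < ε ∧ z ≠ 0 ∧ returnMap d lam z = z) :
    ∀ k ∈ Finset.Icc 1 (d / 2), lam (2 * k) = 0 := by
  set n := d / 2 with hn
  set C : ℝ := 2200 * ((n : ℝ) + 1) with hC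
  have hC0 : 0 < C := by positivity
  have hn1 : (1 : ℝ) ≤ n := by exact_mod_cast hd
  have hS : (0 : ℝ) < 1 / (8 * 2 ^ (10 * n)) := by positivity
  have hST : 1 / (8 * 2 ^ (10 * n)) < 1 / C := one_div_lt_one_div_of_lt hC0 (pow_bound hd)
  set Q : ℂ → ℂ := fun x =>
    ∑ k ∈ Finset.range n, lam (2 * (k + 1)) * (x ^ (2 * k) * (wallisConst (k + 1) : ℂ)) with hQ
  set g : ℂ → ℂ := fun x => (returnMap d lam x - x) / x ^ 3 with hg
  have hsum : ∀ (f : ℕ → ℂ), ∑ k ∈ Finset.Icc 1 n, f k = ∑ k ∈ Finset.range n, f (k + 1) := by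
    intro f
    rw [Finset.range_eq_Ico, Finset.sum_Ico_add' f 0 n 1]
    rfl
  have hsum' : ∀ (f : ℕ → ℝ), ∑ k ∈ Finset.Icc 1 n, f k = ∑ k ∈ Finset.range n, f (k + 1) := by
    intro f
    rw [Finset.range_eq_Ico, Finset.sum_Ico_add' f 0 n 1]
    rfl
  have happ : ∀ x, x ≠ 0 → ‖x‖ < 1 / C → ‖g x - Q x‖ ≤
      C * ∑ k ∈ Finset.range n, ‖lam (2 * (k + 1))‖ * ‖x‖ ^ (2 * k + 1) := by
    intro x hx hxC
    have hx' : 0 < ‖x‖ := norm_pos_iff.2 hx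
    have h1 := norm_returnMap_sub_le hlam hd (x := x) (by
      rw [lt_div_iff₀ hC0] at hxC; rw [mul_comm]; exact hxC.le)
    rw [← hn, hsum, hsum'] at h1
    have h2 : g x - Q x = (returnMap d lam x - x - ∑ k ∈ Finset.range n,
        lam (2 * (k + 1)) * (x ^ (2 * (k + 1) + 1) * (wallisConst (k + 1) : ℂ))) / x ^ 3 := by
      rw [sub_div _ _ (x ^ 3), hg, hQ, Finset.sum_div]
      congr 1
      refine Finset.sum_congr rfl fun k _ => ?_
      rw [eq_div_iff (pow_ne_zero 3 hx)]
      ring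
    rw [h2, norm_div, norm_pow, div_le_iff₀ (by positivity)]
    refine h1.trans_eq ?_
    rw [mul_assoc C, Finset.sum_mul]
    congr 1
    exact Finset.sum_congr rfl fun k _ => by ring
  have hball : Metric.ball (0 : ℂ) (1 / C) ⊆ Metric.ball 0 (1 / 32) :=
    Metric.ball_subset_ball (one_div_le_one_div_of_le (by norm_num) (by rw [hC]; linarith))
  have hw : ∀ k, ‖(wallisConst (k + 1) : ℂ)‖ ≤ 1 := fun k => by
    rw [Complex.norm_real, Real.norm_of_nonneg (wallisConst_pos _).le]
    exact wallisConst_le_one (by omega)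
  -- Division by `x³` leaves a removable singularity at `0`, since `g` is bounded nearby by the
  -- expansion.
  have hG : DifferentiableOn ℂ (Function.update g 0 (Filter.limUnder (nhdsWithin 0 {0}ᶜ) g))
      (Metric.ball 0 (1 / C)) := by
    refine Complex.differentiableOn_update_limUnder_of_bddAbove
      (Metric.ball_mem_nhds _ (one_div_pos.2 hC0)) ?_
      ⟨(C + 1) * ∑ k ∈ Finset.range n, ‖lam (2 * (k + 1))‖, ?_⟩
    · refine DifferentiableOn.div ?_ (by fun_prop) fun x hx => pow_ne_zero 3 hx.2
      exact ((differentiableOn_returnMap hlam).mono (sdiff_subset.trans hball)).sub differentiableOn_id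
    · rintro _ ⟨x, hx, rfl⟩
      have hx1 : ‖x‖ < 1 / C := mem_ball_zero_iff.1 hx.1
      have hx2 : ‖x‖ ≤ 1 := hx1.le.trans ((div_le_one hC0).2 (by rw [hC]; linarith))
      have h1 := happ x hx.2 hx1
      have h2 := norm_le_norm_sub_add (g x) (Q x)
      have h3 : ‖Q x‖ ≤ ∑ k ∈ Finset.range n, ‖lam (2 * (k + 1))‖ := by
        refine norm_sum_le_of_le _ fun k _ => ?_
        rw [norm_mul, norm_mul, norm_pow]
        exact mul_le_of_le_one_right (norm_nonneg _)
          (mul_le_one₀ (pow_le_one₀ (norm_nonneg _) hx2) (norm_nonneg _) (hw k))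
      have h4 : ∑ k ∈ Finset.range n, ‖lam (2 * (k + 1))‖ * ‖x‖ ^ (2 * k + 1) ≤
          ∑ k ∈ Finset.range n, ‖lam (2 * (k + 1))‖ := Finset.sum_le_sum fun k _ =>
        mul_le_of_le_one_right (norm_nonneg _) (pow_le_one₀ (norm_nonneg _) hx2)
      have h5 := mul_le_mul_of_nonneg_left h4 hC0.le
      simp only [Function.comp_apply]
      linarith
  have hzero := coeff_eq_zero_of_zeros (μ := fun k => lam (2 * (k + 1)))
    (w := fun k => wallisConst (k + 1)) hd (wallisConst_pos n)
    (fun k hk => wallisConst_antitone (by omega)) (fun k _ => wallisConst_le_one (by omega)) hG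
    hST hS hC0.le (by
      have := mul_le_mul_of_nonneg_left hST.le hC0.le
      rwa [mul_one_div_cancel hC0.ne'] at this)
    (fun x hx hx' => by rw [Function.update_of_ne hx]; exact happ x hx hx') hε hεS Z hcard
    fun z hz => ⟨(hZ z hz).1, by
      rw [Function.update_of_ne (hZ z hz).2.1, hg]
      simp [(hZ z hz).2.2]⟩
  intro k hk
  have hk' := Finset.mem_Icc.1 hk
  have := hzero (k - 1) (by omega)
  simpa [Nat.sub_add_cancel hk'.1] using this

theorem returnMap_eq_self_of_even_coeff {d : ℕ} {lam : ℕ → ℂ}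
    (hlam : ∑ i ∈ Finset.Icc 1 d, ‖lam i‖ ≤ 1)
    (h0 : ∀ k ∈ Finset.Icc 1 (d / 2), lam (2 * k) = 0) {x : ℂ} (hx : ‖x‖ ≤ 1 / 32) :
    returnMap d lam x = x := by
  obtain ⟨r, hr⟩ := exists_isSmallOrbit hlam hx
  rw [hr.returnMap_eq hlam]
  have he : ∀ u, (damping d lam).eval u = (damping d (oddCoeff lam)).eval u := fun u => by
    rw [eval_damping_eq_add, Finset.sum_eq_zero, add_zero]
    intro k hk
    rw [h0 k hk, zero_mul]
  exact hr.periodic_of_odd hlam fun u => by rw [he, he, eval_damping_oddCoeff_neg]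

/-- This is where `R'` fits the zero estimate: `2^(14n) = 2^(10n) · 16^n` and `π² n ≥ 8`. -/
theorem unit_cycleRadius_le {n : ℕ} (hn : 1 ≤ n) :
    cycleRadius n 1 ≤ 1 / (8 * 2 ^ (10 * n)) * (wallisConst n ^ n / 16 ^ n) := by
  have h0 : 0 ≤ wallisConst n ^ n := pow_nonneg (wallisConst_pos n).le n
  have hn1 : (1 : ℝ) ≤ n := by exact_mod_cast hn
  have h1 : (2 : ℝ) ^ (14 * n) = 2 ^ (10 * n) * 16 ^ n := by
    rw [show 14 * n = 10 * n + 4 * n by ring, pow_add, pow_mul 2 4]; norm_num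
  have h2 : (8 : ℝ) ≤ Real.pi ^ 2 * n := by
    have := Real.pi_gt_three
    nlinarith
  rw [cycleRadius, one_mul, h1, div_mul_div_comm, one_mul]
  refine div_le_div_of_nonneg_left h0 (by positivity) ?_
  rw [mul_assoc 8]
  gcongr

theorem unit_cycleRadius_pos {n : ℕ} (hn : 1 ≤ n) : 0 < cycleRadius n 1 := by
  have := wallisConst_pos n
  have hn1 : (0 : ℝ) < n := by exact_mod_cast hn
  unfold cycleRadius
  positivity

theorem unit_cycleRadius_lt {n : ℕ} (hn : 1 ≤ n) : cycleRadius n 1 < 1 / 32 := by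
  refine (unit_cycleRadius_le hn).trans_lt ?_
  have h1 : wallisConst n ^ n ≤ 1 := pow_le_one₀ (wallisConst_pos n).le (wallisConst_le_one hn)
  have h2 : (16 : ℝ) ≤ 16 ^ n := le_self_pow₀ (by norm_num) (by omega)
  have h3 : (1 : ℝ) ≤ 2 ^ (10 * n) := one_le_pow₀ (by norm_num)
  calc 1 / (8 * 2 ^ (10 * n)) * (wallisConst n ^ n / 16 ^ n) ≤ 1 / (8 * 1) * (1 / 16) := by
        have h0 : 0 ≤ wallisConst n ^ n := pow_nonneg (wallisConst_pos n).le n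
        gcongr
    _ < 1 / 32 := by norm_num

theorem cycleRadius_eq_mul (n : ℕ) (ρ : ℝ) : cycleRadius n ρ = ρ * cycleRadius n 1 := by
  unfold cycleRadius; ring

end Lienard

end

/-! ### The main theorem. -/

theorem mainTheorem1 (d n : ℕ) (hd : 2 ≤ d) (hn : n = d / 2) (lam : ℕ → ℂ)
    (hlam : ∃ i ∈ Finset.Icc 1 d, lam i ≠ 0) :
    (∃! ρ : ℝ, 0 < ρ ∧ ∑ i ∈ Finset.Icc 1 d, ρ ^ i * ‖lam i‖ = 1) ∧
    ∀ ρ : ℝ, 0 < ρ → ∑ i ∈ Finset.Icc 1 d, ρ ^ i * ‖lam i‖ = 1 →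
      (∃ f : ℂ → ℂ, DifferentiableOn ℂ f (Metric.ball 0 (Lienard.cycleRadius n ρ)) ∧
        ∀ x ∈ Metric.ball (0 : ℂ) (Lienard.cycleRadius n ρ), ∀ y : ℂ,
          Lienard.ReturnsTo (Lienard.damping d lam) x y ↔ y = f x) ∧
      {x : ℂ | x ∈ Metric.ball (0 : ℂ) (Lienard.cycleRadius n ρ) ∧
        Lienard.IsComplexLimitCycle (Lienard.damping d lam) x}.Finite ∧
      {x : ℂ | x ∈ Metric.ball (0 : ℂ) (Lienard.cycleRadius n ρ) ∧
        Lienard.IsComplexLimitCycle (Lienard.damping d lam) x}.ncard < 2 * n := by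
  open Lienard in
  subst hn
  have hn1 : 1 ≤ d / 2 := by omega
  refine ⟨existsUnique_weight_eq_one hlam, fun ρ hρ hsum => ?_⟩
  have hρc : (ρ : ℂ) ≠ 0 := by exact_mod_cast hρ.ne'
  set lam' : ℕ → ℂ := fun i => (ρ : ℂ) ^ i * lam i with hlam'
  have hlam1 : ∑ i ∈ Finset.Icc 1 d, ‖lam' i‖ ≤ 1 := by
    refine (Finset.sum_congr rfl fun i _ => ?_).trans_le hsum.le
    rw [hlam', norm_mul, norm_pow, Complex.norm_real, Real.norm_of_nonneg hρ.le]
  set ε := cycleRadius (d / 2) 1 with hε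
  have hlt : ε < 1 / 32 := unit_cycleRadius_lt hn1
  have hnorm : ∀ x : ℂ, x ∈ Metric.ball (0 : ℂ) (cycleRadius (d / 2) ρ) →
      ‖(ρ : ℂ)⁻¹ * x‖ < ε := fun x hx => by
    rw [mem_ball_zero_iff, cycleRadius_eq_mul] at hx
    rwa [norm_mul, norm_inv, Complex.norm_real, Real.norm_of_nonneg hρ.le, inv_mul_lt_iff₀ hρ]
  have hret : ∀ x ∈ Metric.ball (0 : ℂ) (cycleRadius (d / 2) ρ), ∀ y : ℂ,
      ReturnsTo (damping d lam) x y ↔ y = ρ * returnMap d lam' ((ρ : ℂ)⁻¹ * x) := by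
    intro x hx y
    rw [returnsTo_scale_iff d lam hρc, returnsTo_iff hlam1 ((hnorm x hx).trans hlt).le,
      inv_mul_eq_iff_eq_mul₀ hρc]
  refine ⟨⟨_, ?_, hret⟩, ?_⟩
  · refine DifferentiableOn.const_mul ?_ _
    refine (differentiableOn_returnMap hlam1).comp (f := fun x => (ρ : ℂ)⁻¹ * x) (by fun_prop)
      fun x hx => ?_
    exact mem_ball_zero_iff.2 ((hnorm x hx).trans hlt)
  set A := {x : ℂ | x ∈ Metric.ball (0 : ℂ) (cycleRadius (d / 2) ρ) ∧
    IsComplexLimitCycle (damping d lam) x} with hA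
  -- For odd `p` the return map is the identity on the disc, so no fixed point is isolated.
  have hodd : (∀ k ∈ Finset.Icc 1 (d / 2), lam' (2 * k) = 0) → A = ∅ := by
    intro h0
    refine Set.eq_empty_of_forall_notMem ?_
    rintro x ⟨hx, -, -, hiso⟩
    have hev : ∀ᶠ z in nhdsWithin x {x}ᶜ, ReturnsTo (damping d lam) z z := by
      filter_upwards [mem_nhdsWithin_of_mem_nhds (Metric.isOpen_ball.mem_nhds hx)] with z hz
      rw [hret z hz, returnMap_eq_self_of_even_coeff hlam1 h0 ((hnorm z hz).trans hlt).le,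
        mul_inv_cancel_left₀ hρc]
    obtain ⟨z, hz, hz'⟩ := (hev.and hiso).exists
    exact hz' hz
  have hmany : ∀ Z : Finset ℂ, ↑Z ⊆ A → Z.card = 2 * (d / 2) → False := by
    intro Z hZA hcard
    have hinj : Function.Injective fun x : ℂ => (ρ : ℂ)⁻¹ * x := mul_right_injective₀ (inv_ne_zero hρc)
    have h0 := even_coeff_eq_zero_of_fixed_points hlam1 hn1 (unit_cycleRadius_pos hn1)
      (unit_cycleRadius_le hn1) (Z.map ⟨_, hinj⟩) (by rw [Finset.card_map, hcard]) fun z hz => by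
        obtain ⟨x, hx, rfl⟩ := Finset.mem_map.1 hz
        obtain ⟨hxb, hx0, hxr, -⟩ := hZA hx
        refine ⟨hnorm x hxb, mul_ne_zero (inv_ne_zero hρc) hx0, ?_⟩
        have h1 := (hret x hxb x).1 hxr
        exact (eq_inv_mul_iff_mul_eq₀ hρc).2 h1.symm
    rw [hodd h0] at hZA
    have : Z.card = 0 := by
      rw [Finset.card_eq_zero, ← Finset.coe_eq_empty]
      exact Set.subset_empty_iff.1 hZA
    omega
  -- Finiteness is needed separately, because `ncard` of an infinite set is `0`.
  have hfin : A.Finite := by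
    by_contra hinf
    obtain ⟨Z, hZ, hcard⟩ := Set.Infinite.exists_subset_card_eq hinf (2 * (d / 2))
    exact hmany Z hZ hcard
  refine ⟨hfin, ?_⟩
  by_contra hge
  push Not at hge
  rw [Set.ncard_eq_toFinset_card A hfin] at hge
  obtain ⟨Z, hZ, hcard⟩ := Finset.exists_subset_card_eq hge
  exact hmany Z (fun x hx => hfin.mem_toFinset.1 (hZ hx)) hcard
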